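/- Let $\mathcal X$ be a measurable space, let $n\ge 1$, let $f:\mathcal X^n\to\mathbb R$ be bounded and measurable, and let $X_1,\dots,X_{n+1}$ be i.i.d. random variables with values in $\mathcal X$; write $\mathbf X=(X_1,\dots,X_{n+1})$ and $f(\mathbf X)=f(X_1,\dots,X_n)$. For $k\in\{1,\dots,n\}$ and $y,y'\in\mathcal X$ let $D^k_{y,y'}f(\mathbf x)=f(x_1,\dots,x_{k-1},y,x_{k+1},\dots,x_n)-f(x_1,\dots,x_{k-1},y',x_{k+1},\dots,x_n)$, and put $$M(f)=\max_{k}\sup_{\mathbf x,y,y'}D^k_{y,y'}f(\mathbf x),\qquad J(f)=n\max_{l\ne k}\sup_{\mathbf x,y,y',z,z'}D^l_{z,z'}D^k_{y,y'}f(\mathbf x)$$ (with $J(f)=0$ if $n=1$). Let $a>0$ and $b\ge 0$, and suppose that $f$ has $(a,b)$-weak interactions, that is, $M(f)\le a/n$ and $J(f)\le b/n$. For $\mathbf x\in\mathcal X^{n+1}$ define $$v_f(\mathbf x)=\frac1{2(n+1)}\sum_{j=1}^{n+1}\sum_{i\ne j}\bigl(f(S_-^j\mathbf x)-f(S_-^jS^i_{x_j}\mathbf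 x)\bigr)^2,$$ where $S_-^j$ deletes the $j$-th component and $S^i_y$ replaces the $i$-th component by $y$, and put $K_-(a,b)=b/2+\sqrt{2a^2+8b^2}$. For a bounded real random variable $W$ with mean $E[W]$ and standard deviation $\sigma(W)$ let $$d_{\mathcal N}(W)=\sup\Bigl\{\Bigl|E\Bigl[h\Bigl(\frac{W-E[W]}{\sigma(W)}\Bigr)\Bigr]-E[h(Z)]\Bigr|:\ h:\mathbb R\to\mathbb R\text{ Lipschitz with constant }1\Bigr\},\qquad Z\sim\mathcal N(0,1).$$ For $\delta>0$ consider the events $$A(\delta)=\Bigl\{\frac{\sqrt{v_f(\mathbf X)}}2\ge\frac{K_-(a,b)\sqrt{\ln(1/\delta)}}n\Bigr\},\qquad B=\Bigl\{d_{\mathcal N}(f(\mathbf X))\le\frac{4(a^2+ab)}{v_f(\mathbf X)\,n^{3/2}}+\frac{4a^3}{v_f(\mathbf X)^{3/2}\,n^2}\Bigr\}.$$ Then $\Pr\bigl(A(\delta)\Rightarrow B\bigr)\ge 1-\delta$. (For $\delta\ge 1$ the assertion is trivial.) -/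

import Mathlib

open MeasureTheory ProbabilityTheory
open scoped ENNReal NNReal

noncomputable section

namespace WeakInteractions

/-- The algebra of bounded measurable real functions on `𝒳 ^ n`. -/
def IsBoundedMeasurable {𝒳 : Type*} [MeasurableSpace 𝒳] {n : ℕ}
    (f : (Fin n → 𝒳) → ℝ) : Prop :=
  Measurable f ∧ ∃ C : ℝ, ∀ x, |f x| ≤ C

/-- The partial difference operator
`D^k_{y,y'} f (x) = f (x₁,…,y,…,xₙ) - f (x₁,…,y',…,xₙ)` (substitution at position `k`). -/
def partialDiff {𝒳 : Type*} {n : ℕ} (k : Fin n) (y y' : 𝒳)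
    (f : (Fin n → 𝒳) → ℝ) : (Fin n → 𝒳) → ℝ :=
  fun x => f (Function.update x k y) - f (Function.update x k y')

/-- The seminorm `M(f) = max_k sup_{x,y,y'} D^k_{y,y'} f (x)`, for bounded `f`. -/
def seminormM {𝒳 : Type*} {n : ℕ} (f : (Fin n → 𝒳) → ℝ) : ℝ :=
  sSup {r : ℝ | ∃ (k : Fin n) (x : Fin n → 𝒳) (y y' : 𝒳), r = partialDiff k y y' f x}

/-- The seminorm `J(f) = n max_{l ≠ k} sup_{x,y,y',z,z'} D^l_{z,z'} D^k_{y,y'} f (x)`,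
for bounded `f`. For `n = 1` there is no pair `l ≠ k`, and `J(f) = 0`. -/
def seminormJ {𝒳 : Type*} {n : ℕ} (f : (Fin n → 𝒳) → ℝ) : ℝ :=
  (n : ℝ) * sSup {r : ℝ | ∃ (l k : Fin n) (x : Fin n → 𝒳) (z z' y y' : 𝒳),
    l ≠ k ∧ r = partialDiff l z z' (partialDiff k y y' f) x}

/-- `(a,b)`-weak interactions of a (bounded) function `f` on `𝒳 ^ n`. -/
def HasWeakInteractions {𝒳 : Type*} {n : ℕ} (a b : ℝ) (f : (Fin n → 𝒳) → ℝ) : Prop :=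
  seminormM f ≤ a / n ∧ seminormJ f ≤ b / n

/-- The variance estimator: a function of `n + 1` observations,
`v_f (x) = 1 / (2 (n + 1)) * ∑_j ∑_{i ≠ j} (f (S₋^j x) - f (S₋^j S^i_{x_j} x))²`,
where `S₋^j` deletes the `j`-th component and `S^i_y` replaces the `i`-th component by `y`. -/
def varEstimator {𝒳 : Type*} {n : ℕ} (f : (Fin n → 𝒳) → ℝ) (x : Fin (n + 1) → 𝒳) : ℝ :=
  1 / (2 * ((n : ℝ) + 1)) *
    ∑ j : Fin (n + 1), ∑ i ∈ Finset.univ.filter (fun i : Fin (n + 1) => i ≠ j),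
      (f (j.removeNth x) - f (j.removeNth (Function.update x i (x j)))) ^ 2

/-- The constant `K₋(a,b) = b / 2 + √(2 a² + 8 b²)`. -/
def Kminus (a b : ℝ) : ℝ := b / 2 + √(2 * a ^ 2 + 8 * b ^ 2)

/-- Distance to normality of a real random variable `W`: the supremum over all real Lipschitz-1
functions `h` of `|E[h((W - E W) / σ(W))] - E[h(Z)]|`, with `Z` standard normal. -/
def distNormal {Ω : Type*} [MeasurableSpace Ω] (P : Measure Ω) (W : Ω → ℝ) : ℝ≥0∞ :=
  ⨆ (h : ℝ → ℝ) (_ : LipschitzWith 1 h),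
    ENNReal.ofReal |(∫ ω, h ((W ω - ∫ ω', W ω' ∂P) / √(variance W P)) ∂P)
      - ∫ z, h z ∂(gaussianReal 0 1)|

end WeakInteractions

end

/-!
The implication can only fail if the variance estimator `v` is much larger than the variance `σ²`
of `f`, and the proof shows that this is an event of probability at most `δ`.

**Normal approximation.** By Stein's method, `d_N(f(X)) ≤ (a² + ab) / (σ² n^{3/2}) + a³ / (2 σ³ n²)`
(`abs_integral_sub_gaussian_le`). The bounded solution `φ` of Stein's equation for a differentiable
1-Lipschitz test function satisfies `|φ| ≤ 1`, `|φ'| ≤ 2` and `|φ''| ≤ 4`, by the maximum principle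
and by comparison with explicit supersolutions (`exists_stein_solution`). With an independent copy
`X'` of the sample, replacing the coordinates of `X` one after the other and symmetrizing each step
(`integral_mul_sub_integral_mul_swapAt`) gives `E[g φ(g)] ≈ E[φ'(g) T]` for the standardized `g`, a
telescoping form of Chatterjee's argument; bounded differences of first and second order control
both the Taylor error and the fluctuation of `E[T | X]`, the latter by the Efron–Stein inequality.
Hence, if `v ≤ 4 σ²`, the bound in terms of `v` follows from the one in terms of `σ²`.

**Bias.** `E[v]` is the Efron–Stein bound for the variance, and the same telescoping applied a
second time shows that it exceeds `σ²` by at most `b² / (4 n²)` (`efronStein_le_variance_add`).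

**Concentration.** The amounts `w_k` by which changing the `k`-th observation can decrease `v`
satisfy `∑ w_k² ≤ A v` with `A = (3 a² + 12 b²) / n²` (`sum_sq_decreaseBound_le`). Tensorization of
entropy and the Herbst argument then give `P(v ≥ V) ≤ exp (-(V - 2 E[v]) / A)`
(`measureReal_ge_le_of_selfBounding`).

**Conclusion.** Where the implication fails, `v` is at least `4 K² ln(1/δ) / n²`, at least `4 σ²`,
and, since `d_N ≤ 2` always, at least `8 b² / n²`, which dominates the bias
(`le_varEstimate_of_normal_bound_lt`). For `V` the largest of these three numbers,
`(V - 2 E[v]) / A ≥ (7/16) V / A ≥ ln(1/δ)`.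
-/

namespace WeakInteractions

/-! ### Bounded measurable functions -/

/-- Bounded measurable real functions on an arbitrary measurable space; on `Fin n → 𝒳` this is
`IsBoundedMeasurable`. -/
structure BddMeas {α : Type*} [MeasurableSpace α] (F : α → ℝ) : Prop where
  measurable : Measurable F
  bounded : ∃ C : ℝ, ∀ x, |F x| ≤ C

namespace BddMeas

variable {α β : Type*} [MeasurableSpace α] [MeasurableSpace β] {F G : α → ℝ}

theorem const (c : ℝ) : BddMeas (fun _ : α => c) := ⟨measurable_const, |c|, fun _ => le_rfl⟩

theorem add (hF : BddMeas F) (hG : BddMeas G) : BddMeas (fun x => F x + G x) := by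
  obtain ⟨C, hC⟩ := hF.bounded
  obtain ⟨D, hD⟩ := hG.bounded
  exact ⟨hF.measurable.add hG.measurable, C + D,
    fun x => (abs_add_le _ _).trans (add_le_add (hC x) (hD x))⟩

theorem neg (hF : BddMeas F) : BddMeas (fun x => -F x) := by
  obtain ⟨C, hC⟩ := hF.bounded
  exact ⟨hF.measurable.neg, C, fun x => by simpa using hC x⟩

theorem sub (hF : BddMeas F) (hG : BddMeas G) : BddMeas (fun x => F x - G x) := by
  simpa [sub_eq_add_neg] using hF.add hG.neg

theorem mul (hF : BddMeas F) (hG : BddMeas G) : BddMeas (fun x => F x * G x) := by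
  obtain ⟨C, hC⟩ := hF.bounded
  obtain ⟨D, hD⟩ := hG.bounded
  refine ⟨hF.measurable.mul hG.measurable, C * D, fun x => ?_⟩
  rw [abs_mul]
  exact mul_le_mul (hC x) (hD x) (abs_nonneg _) ((abs_nonneg _).trans (hC x))

theorem const_mul (c : ℝ) (hF : BddMeas F) : BddMeas (fun x => c * F x) := (const c).mul hF

theorem sq (hF : BddMeas F) : BddMeas (fun x => F x ^ 2) := by
  simpa [pow_two] using hF.mul hF

theorem abs (hF : BddMeas F) : BddMeas (fun x => |F x|) := by
  obtain ⟨C, hC⟩ := hF.bounded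
  exact ⟨by simpa [Real.norm_eq_abs] using hF.measurable.norm, C, fun x => by simpa using hC x⟩

theorem comp (hF : BddMeas F) {T : β → α} (hT : Measurable T) : BddMeas (fun x => F (T x)) := by
  obtain ⟨C, hC⟩ := hF.bounded
  exact ⟨hF.measurable.comp hT, C, fun x => hC _⟩

theorem continuous_comp (hF : BddMeas F) {φ : ℝ → ℝ} (hφ : Continuous φ) :
    BddMeas (fun x => φ (F x)) := by
  obtain ⟨C, hC⟩ := hF.bounded
  obtain ⟨D, hD⟩ := (isCompact_Icc (a := -C) (b := C)).exists_bound_of_continuousOn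
    hφ.continuousOn
  exact ⟨hφ.measurable.comp hF.measurable, D, fun x => hD _ (abs_le.1 (hC x))⟩

theorem sum {ι : Type*} (s : Finset ι) {H : ι → α → ℝ} (hH : ∀ i ∈ s, BddMeas (H i)) :
    BddMeas (fun x => ∑ i ∈ s, H i x) := by
  classical
  induction s using Finset.induction_on with
  | empty => simpa using const 0
  | insert i s hi ih =>
    simp only [Finset.sum_insert hi]
    exact (hH i (by simp)).add (ih fun j hj => hH j (by simp [hj]))

theorem integrable {ρ : Measure α} [IsFiniteMeasure ρ] (hF : BddMeas F) : Integrable F ρ := by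
  obtain ⟨C, hC⟩ := hF.bounded
  exact Integrable.of_bound hF.measurable.aestronglyMeasurable C (Filter.Eventually.of_forall hC)

theorem integral_right {ν : Measure β} [IsProbabilityMeasure ν] {K : α → β → ℝ}
    (hK : BddMeas (fun p : α × β => K p.1 p.2)) : BddMeas (fun x => ∫ y, K x y ∂ν) := by
  obtain ⟨C, hC⟩ := hK.bounded
  refine ⟨(hK.measurable.stronglyMeasurable.integral_prod_right' (ν := ν)).measurable, C,
    fun x => ?_⟩
  have := norm_integral_le_of_norm_le_const (μ := ν) (f := fun y => K x y) (C := C)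
    (Filter.Eventually.of_forall fun y => hC (x, y))
  simpa using this

theorem integral_left {μ : Measure α} [IsProbabilityMeasure μ] {K : α → β → ℝ}
    (hK : BddMeas (fun p : α × β => K p.1 p.2)) : BddMeas (fun y => ∫ x, K x y ∂μ) :=
  integral_right (K := fun y x => K x y) (hK.comp measurable_swap)

theorem slice_left {K : α → β → ℝ} (hK : BddMeas (fun p : α × β => K p.1 p.2)) (x : α) :
    BddMeas (K x) := hK.comp (T := fun y => (x, y)) (by fun_prop)

theorem slice_right {K : α → β → ℝ} (hK : BddMeas (fun p : α × β => K p.1 p.2)) (y : β) :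
    BddMeas (fun x => K x y) := hK.comp (T := fun x => (x, y)) (by fun_prop)

end BddMeas

theorem integral_comp_of_measurePreserving {α β : Type*} [MeasurableSpace α] [MeasurableSpace β]
    {ρ : Measure α} {ν : Measure β} {T : α → β} (hT : MeasurePreserving T ρ ν) {F : β → ℝ}
    (hF : Measurable F) : ∫ x, F (T x) ∂ρ = ∫ y, F y ∂ν := by
  rw [← hT.map_eq, integral_map hT.measurable.aemeasurable hF.aestronglyMeasurable]

/-! ### Exchanging coordinates of two independent samples -/

section Swap

variable {𝒳 : Type*} {n : ℕ}

/-- Exchange the coordinates with index in `A` between the two samples `z.1` and `z.2`. The index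
set is a set of natural numbers, so that the sets `{i}` and `{0, …, m - 1}` need no coercions. -/
def swapAt (A : Finset ℕ) (z : (Fin n → 𝒳) × (Fin n → 𝒳)) : (Fin n → 𝒳) × (Fin n → 𝒳) :=
  (fun i => if (i : ℕ) ∈ A then z.2 i else z.1 i, fun i => if (i : ℕ) ∈ A then z.1 i else z.2 i)

theorem swapAt_swapAt_self (A : Finset ℕ) (z : (Fin n → 𝒳) × (Fin n → 𝒳)) :
    swapAt A (swapAt A z) = z := by
  ext i <;> simp only [swapAt] <;> split_ifs <;> rfl

theorem swapAt_comm (A B : Finset ℕ) (z : (Fin n → 𝒳) × (Fin n → 𝒳)) :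
    swapAt A (swapAt B z) = swapAt B (swapAt A z) := by
  ext i <;> simp only [swapAt] <;> split_ifs <;> rfl

theorem swapAt_range_succ (m : ℕ) (z : (Fin n → 𝒳) × (Fin n → 𝒳)) :
    swapAt {m} (swapAt (Finset.range m) z) = swapAt (Finset.range (m + 1)) z := by
  ext i <;> simp only [swapAt, Finset.mem_singleton, Finset.mem_range] <;> split_ifs <;>
    first | rfl | omega

theorem swapAt_range_zero (z : (Fin n → 𝒳) × (Fin n → 𝒳)) :
    swapAt (Finset.range 0) z = z := by
  ext i <;> simp [swapAt]

theorem swapAt_range_self (z : (Fin n → 𝒳) × (Fin n → 𝒳)) :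
    swapAt (Finset.range n) z = (z.2, z.1) := by
  ext i <;> simp [swapAt]

theorem swapAt_singleton_fst (j : Fin n) (z : (Fin n → 𝒳) × (Fin n → 𝒳)) :
    (swapAt {(j : ℕ)} z).1 = Function.update z.1 j (z.2 j) := by
  ext i
  by_cases h : i = j
  · subst h; simp [swapAt]
  · simp [swapAt, h, Fin.val_inj]

variable [MeasurableSpace 𝒳]

theorem measurable_swapAt (A : Finset ℕ) :
    Measurable (swapAt A : (Fin n → 𝒳) × (Fin n → 𝒳) → _) := by
  refine Measurable.prodMk ?_ ?_ <;> refine measurable_pi_lambda _ fun i => ?_ <;> split_ifs <;>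
    fun_prop

variable (μ : Measure 𝒳) [IsProbabilityMeasure μ]

theorem measurePreserving_swapAt (A : Finset ℕ) :
    MeasurePreserving (swapAt (n := n) (𝒳 := 𝒳) A)
      ((Measure.pi fun _ : Fin n => μ).prod (Measure.pi fun _ : Fin n => μ))
      ((Measure.pi fun _ : Fin n => μ).prod (Measure.pi fun _ : Fin n => μ)) := by
  have e := measurePreserving_arrowProdEquivProdArrow 𝒳 𝒳 (Fin n) (fun _ => μ) (fun _ => μ)
  have h : MeasurePreserving
      (fun (a : Fin n → 𝒳 × 𝒳) (i : Fin n) => (if (i : ℕ) ∈ A then Prod.swap else id) (a i))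
      (Measure.pi fun _ => μ.prod μ) (Measure.pi fun _ => μ.prod μ) := by
    refine measurePreserving_pi _ _ fun i => ?_
    split_ifs
    · exact Measure.measurePreserving_swap
    · exact MeasurePreserving.id _
  have := e.comp (h.comp e.symm)
  convert this using 1
  ext z i <;> simp only [swapAt, Function.comp_apply] <;>
    simp [MeasurableEquiv.arrowProdEquivProdArrow, Equiv.arrowProdEquivProdArrow] <;>
    split_ifs <;> rfl

/-- Telescoping along the interpolation from the first sample to the second, followed by a
symmetrization of each increment under the exchange of the coordinate that it changes. -/
theorem integral_mul_sub_integral_mul_swapAt {F G : (Fin n → 𝒳) × (Fin n → 𝒳) → ℝ}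
    (hF : BddMeas F) (hG : BddMeas G) (m : ℕ) :
    (∫ z, F z * G z ∂((Measure.pi fun _ : Fin n => μ).prod (Measure.pi fun _ : Fin n => μ)))
      - ∫ z, F z * G (swapAt (Finset.range m) z)
          ∂((Measure.pi fun _ : Fin n => μ).prod (Measure.pi fun _ : Fin n => μ))
      = ∑ i ∈ Finset.range m, (1 / 2) * ∫ z, (F z - F (swapAt {i} z)) *
          (G (swapAt (Finset.range i) z) - G (swapAt {i} (swapAt (Finset.range i) z)))
          ∂((Measure.pi fun _ : Fin n => μ).prod (Measure.pi fun _ : Fin n => μ)) := by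
  set ρ : Measure ((Fin n → 𝒳) × (Fin n → 𝒳)) :=
    (Measure.pi fun _ : Fin n => μ).prod (Measure.pi fun _ : Fin n => μ)
  induction m with
  | zero => simp only [swapAt_range_zero]; simp
  | succ m ih =>
    rw [Finset.sum_range_succ, ← ih]
    have hs (A : Finset ℕ) := measurable_swapAt (n := n) (𝒳 := 𝒳) A
    have hGs (A : Finset ℕ) := hG.comp (hs A)
    set H : (Fin n → 𝒳) × (Fin n → 𝒳) → ℝ := fun z =>
      G (swapAt (Finset.range m) z) - G (swapAt {m} (swapAt (Finset.range m) z)) with hH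
    have hHb : BddMeas H := (hGs _).sub ((hGs {m}).comp (hs _))
    have hanti : ∀ z, H (swapAt {m} z) = -H z := fun z => by
      simp only [hH]
      rw [swapAt_comm (Finset.range m) {m}, swapAt_swapAt_self]
      ring
    have h1 : ∫ z, F (swapAt {m} z) * H z ∂ρ = -∫ z, F z * H z ∂ρ := by
      rw [← integral_comp_of_measurePreserving (measurePreserving_swapAt (n := n) μ {m})
        (F := fun z => F z * H z) (hF.mul hHb).measurable, ← integral_neg]
      refine integral_congr_ae (Filter.Eventually.of_forall fun z => ?_)
      simp only [hanti]; ring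
    have h2 : ∫ z, (F z - F (swapAt {m} z)) * H z ∂ρ
        = ∫ z, F z * H z ∂ρ - ∫ z, F (swapAt {m} z) * H z ∂ρ := by
      rw [← integral_sub (hF.mul hHb).integrable ((hF.comp (hs _)).mul hHb).integrable]
      exact integral_congr_ae (Filter.Eventually.of_forall fun z => by ring)
    have h3 : ∫ z, F z * H z ∂ρ = ∫ z, F z * G (swapAt (Finset.range m) z) ∂ρ
        - ∫ z, F z * G (swapAt (Finset.range (m + 1)) z) ∂ρ := by
      rw [← integral_sub (hF.mul (hGs _)).integrable (hF.mul (hGs _)).integrable]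
      refine integral_congr_ae (Filter.Eventually.of_forall fun z => ?_)
      simp only [hH, ← swapAt_range_succ]; ring
    rw [h2, h1, h3]; ring

theorem integral_mul_swapAt_le {H : (Fin n → 𝒳) × (Fin n → 𝒳) → ℝ} (hH : BddMeas H)
    (A : Finset ℕ) :
    ∫ z, H z * H (swapAt A z)
        ∂((Measure.pi fun _ : Fin n => μ).prod (Measure.pi fun _ : Fin n => μ))
      ≤ ∫ z, H z ^ 2 ∂((Measure.pi fun _ : Fin n => μ).prod (Measure.pi fun _ : Fin n => μ)) := by
  have hHA := hH.comp (measurable_swapAt (n := n) (𝒳 := 𝒳) A)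
  have h := integral_comp_of_measurePreserving (measurePreserving_swapAt (n := n) μ A)
    hH.sq.measurable
  have h2 : ∫ z, H z * H (swapAt A z)
        ∂((Measure.pi fun _ : Fin n => μ).prod (Measure.pi fun _ : Fin n => μ))
      ≤ ∫ z, (1 / 2) * (H z ^ 2 + H (swapAt A z) ^ 2)
        ∂((Measure.pi fun _ : Fin n => μ).prod (Measure.pi fun _ : Fin n => μ)) :=
    integral_mono (hH.mul hHA).integrable ((hH.sq.add hHA.sq).const_mul _).integrable
      fun z => by nlinarith [sq_nonneg (H z - H (swapAt A z))]
  rw [integral_const_mul, integral_add hH.sq.integrable hHA.sq.integrable, h] at h2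
  linarith

theorem integral_sq_sub_integral_mul_swapAt_le {G : (Fin n → 𝒳) × (Fin n → 𝒳) → ℝ}
    (hG : BddMeas G) (m : ℕ) :
    (∫ z, G z ^ 2 ∂((Measure.pi fun _ : Fin n => μ).prod (Measure.pi fun _ : Fin n => μ)))
      - ∫ z, G z * G (swapAt (Finset.range m) z)
          ∂((Measure.pi fun _ : Fin n => μ).prod (Measure.pi fun _ : Fin n => μ))
      ≤ ∑ i ∈ Finset.range m, (1 / 2) * ∫ z, (G z - G (swapAt {i} z)) ^ 2
          ∂((Measure.pi fun _ : Fin n => μ).prod (Measure.pi fun _ : Fin n => μ)) := by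
  have h := integral_mul_sub_integral_mul_swapAt (n := n) μ hG hG m
  simp only [← pow_two] at h
  rw [h]
  refine Finset.sum_le_sum fun i _ => mul_le_mul_of_nonneg_left ?_ (by norm_num)
  have := integral_mul_swapAt_le (n := n) μ (hG.sub (hG.comp (measurable_swapAt {i})))
    (Finset.range i)
  exact this

/-! ### The Efron–Stein inequality and the excess of its upper bound -/

theorem integral_fst_mul_snd {u : (Fin n → 𝒳) → ℝ} :
    ∫ z, u z.1 * u z.2 ∂((Measure.pi fun _ : Fin n => μ).prod (Measure.pi fun _ : Fin n => μ))
      = (∫ x, u x ∂(Measure.pi fun _ : Fin n => μ)) ^ 2 := by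
  rw [integral_prod_mul, pow_two]

theorem integral_comp_fst {u : (Fin n → 𝒳) → ℝ} (hu : Measurable u) :
    ∫ z, u z.1 ∂((Measure.pi fun _ : Fin n => μ).prod (Measure.pi fun _ : Fin n => μ))
      = ∫ x, u x ∂(Measure.pi fun _ : Fin n => μ) :=
  integral_comp_of_measurePreserving measurePreserving_fst hu

theorem variance_pi_eq {u : (Fin n → 𝒳) → ℝ} (hu : BddMeas u) :
    variance u (Measure.pi fun _ : Fin n => μ)
      = (∫ z, u z.1 ^ 2 ∂((Measure.pi fun _ : Fin n => μ).prod (Measure.pi fun _ : Fin n => μ)))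
        - ∫ z, u z.1 * u (swapAt (Finset.range n) z).1
          ∂((Measure.pi fun _ : Fin n => μ).prod (Measure.pi fun _ : Fin n => μ)) := by
  have hL : MemLp u 2 (Measure.pi fun _ : Fin n => μ) := by
    obtain ⟨C, hC⟩ := hu.bounded
    exact MemLp.of_bound hu.measurable.aestronglyMeasurable C (Filter.Eventually.of_forall hC)
  rw [variance_eq_sub hL]
  simp only [swapAt_range_self, Pi.pow_apply]
  rw [integral_fst_mul_snd, integral_comp_fst (u := fun x => u x ^ 2) μ hu.sq.measurable]

/-- The **Efron–Stein inequality**. -/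
theorem variance_pi_le {u : (Fin n → 𝒳) → ℝ} (hu : BddMeas u) :
    variance u (Measure.pi fun _ : Fin n => μ)
      ≤ ∑ i ∈ Finset.range n, (1 / 2) * ∫ z, (u z.1 - u (swapAt {i} z).1) ^ 2
          ∂((Measure.pi fun _ : Fin n => μ).prod (Measure.pi fun _ : Fin n => μ)) := by
  rw [variance_pi_eq μ hu]
  exact integral_sq_sub_integral_mul_swapAt_le (n := n) μ
    (hu.comp (T := fun z : (Fin n → 𝒳) × (Fin n → 𝒳) => z.1) measurable_fst) n

/-- The Efron–Stein bound exceeds the variance by an amount controlled by the second order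
differences: both sides of the Efron–Stein inequality telescope, and the gap between the `j`-th
terms is again of Efron–Stein type for the function `Δ_j u`. -/
theorem efronStein_le_variance_add {u : (Fin n → 𝒳) → ℝ} (hu : BddMeas u) {β : ℝ}
    (hβ : ∀ i j : ℕ, i ≠ j → ∀ z : (Fin n → 𝒳) × (Fin n → 𝒳),
      |u z.1 - u (swapAt {j} z).1 - (u (swapAt {i} z).1 - u (swapAt {j} (swapAt {i} z)).1)| ≤ β) :
    ∑ j ∈ Finset.range n, (1 / 2) * ∫ z, (u z.1 - u (swapAt {j} z).1) ^ 2
          ∂((Measure.pi fun _ : Fin n => μ).prod (Measure.pi fun _ : Fin n => μ))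
      ≤ variance u (Measure.pi fun _ : Fin n => μ) + n ^ 2 * β ^ 2 / 4 := by
  set ρ : Measure ((Fin n → 𝒳) × (Fin n → 𝒳)) :=
    (Measure.pi fun _ : Fin n => μ).prod (Measure.pi fun _ : Fin n => μ)
  have hs (A : Finset ℕ) := measurable_swapAt (n := n) (𝒳 := 𝒳) A
  have hU : BddMeas (fun z : (Fin n → 𝒳) × (Fin n → 𝒳) => u z.1) := hu.comp measurable_fst
  have hW (j : ℕ) : BddMeas (fun z : (Fin n → 𝒳) × (Fin n → 𝒳) => u z.1 - u (swapAt {j} z).1) :=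
    hU.sub (hU.comp (hs {j}))
  have hvar : variance u (Measure.pi fun _ : Fin n => μ) = ∑ j ∈ Finset.range n, (1 / 2) *
      ∫ z, (u z.1 - u (swapAt {j} z).1) * (u (swapAt (Finset.range j) z).1
        - u (swapAt {j} (swapAt (Finset.range j) z)).1) ∂ρ := by
    rw [variance_pi_eq μ hu, ← integral_mul_sub_integral_mul_swapAt μ hU hU n]
    simp only [pow_two]
  have hterm : ∀ j ∈ Finset.range n,
      (1 / 2) * ∫ z, (u z.1 - u (swapAt {j} z).1) ^ 2 ∂ρ ≤ (1 / 2) *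
      (∫ z, (u z.1 - u (swapAt {j} z).1) * (u (swapAt (Finset.range j) z).1
        - u (swapAt {j} (swapAt (Finset.range j) z)).1) ∂ρ) + n * β ^ 2 / 4 := by
    intro j hj
    have h := integral_sq_sub_integral_mul_swapAt_le (n := n) μ (hW j) j
    have h2 : ∑ i ∈ Finset.range j, (1 / 2) * ∫ z, (u z.1 - u (swapAt {j} z).1 -
        (u (swapAt {i} z).1 - u (swapAt {j} (swapAt {i} z)).1)) ^ 2 ∂ρ
        ≤ ∑ i ∈ Finset.range j, (1 / 2) * β ^ 2 := by
      refine Finset.sum_le_sum fun i hi => mul_le_mul_of_nonneg_left ?_ (by norm_num)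
      have := integral_mono (μ := ρ) ((hW j).sub ((hW j).comp (hs {i}))).sq.integrable
        (integrable_const (β ^ 2)) fun z => by
          have := hβ i j (by simp at hi; omega) z
          exact sq_le_sq' (abs_le.1 this).1 (abs_le.1 this).2
      simpa using this
    rw [Finset.sum_const, Finset.card_range, nsmul_eq_mul] at h2
    have h3 : (j : ℝ) ≤ n := by simp at hj; exact_mod_cast hj.le
    have h4 : (j : ℝ) * β ^ 2 ≤ n * β ^ 2 := mul_le_mul_of_nonneg_right h3 (sq_nonneg _)
    have h5 := h.trans h2
    change (∫ z, (u z.1 - u (swapAt {j} z).1) ^ 2 ∂ρ) - ∫ z, (u z.1 - u (swapAt {j} z).1) *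
      (u (swapAt (Finset.range j) z).1 - u (swapAt {j} (swapAt (Finset.range j) z)).1) ∂ρ ≤ _ at h5
    linarith
  refine (Finset.sum_le_sum hterm).trans ?_
  rw [Finset.sum_add_distrib, ← hvar, Finset.sum_const, Finset.card_range, nsmul_eq_mul]
  apply le_of_eq; ring

end Swap

/-! ### Resampling one coordinate -/

section Resample

variable {𝒳 : Type*} {n : ℕ} [MeasurableSpace 𝒳] (μ : Measure 𝒳) [IsProbabilityMeasure μ]

theorem measurable_update_prod (j : Fin n) :
    Measurable (fun p : (Fin n → 𝒳) × 𝒳 => Function.update p.1 j p.2) := by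
  refine measurable_pi_lambda _ fun i => ?_
  by_cases h : i = j
  · subst h; simpa using measurable_snd
  · simp only [Function.update_of_ne h]; fun_prop

theorem measurePreserving_update (j : Fin n) :
    MeasurePreserving (fun p : (Fin n → 𝒳) × 𝒳 => Function.update p.1 j p.2)
      ((Measure.pi fun _ : Fin n => μ).prod μ) (Measure.pi fun _ : Fin n => μ) := by
  refine ⟨measurable_update_prod j, (Measure.pi_eq fun s hs => ?_).symm⟩
  rw [Measure.map_apply (measurable_update_prod j) (MeasurableSet.univ_pi hs)]
  have : (fun p : (Fin n → 𝒳) × 𝒳 => Function.update p.1 j p.2) ⁻¹' Set.univ.pi s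
      = (Set.univ.pi (Function.update s j Set.univ)) ×ˢ s j := by
    ext ⟨x, y⟩
    simp only [Set.mem_preimage, Set.mem_pi, Set.mem_univ, true_imp_iff, Set.mem_prod]
    constructor
    · intro h
      refine ⟨fun i => ?_, by simpa using h j⟩
      by_cases hi : i = j
      · subst hi; simp
      · simpa [hi] using h i
    · rintro ⟨h, hy⟩ i
      by_cases hi : i = j
      · subst hi; simpa using hy
      · simpa [hi] using h i
  rw [this, Measure.prod_prod, Measure.pi_pi,
    ← Finset.mul_prod_erase Finset.univ _ (Finset.mem_univ j),
    ← Finset.mul_prod_erase Finset.univ (fun i => μ (s i)) (Finset.mem_univ j)]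
  rw [Finset.prod_congr rfl (g := fun i => μ (s i)) fun i hi => by
    rw [Function.update_of_ne (Finset.ne_of_mem_erase hi)]]
  simp [mul_comm]

theorem integral_integral_update {G : (Fin n → 𝒳) → ℝ} (hG : BddMeas G) (j : Fin n) :
    ∫ x, ∫ y, G (Function.update x j y) ∂μ ∂(Measure.pi fun _ : Fin n => μ)
      = ∫ x, G x ∂(Measure.pi fun _ : Fin n => μ) := by
  rw [← integral_comp_of_measurePreserving (measurePreserving_update μ j) hG.measurable,
    integral_prod _ (hG.comp (measurable_update_prod j)).integrable]

theorem integral_swapAt_singleton_eq {F : (Fin n → 𝒳) → (Fin n → 𝒳) → ℝ}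
    (hF : BddMeas (fun p : (Fin n → 𝒳) × (Fin n → 𝒳) => F p.1 p.2)) (j : Fin n) :
    ∫ z, F z.1 (swapAt {(j : ℕ)} z).1
        ∂((Measure.pi fun _ : Fin n => μ).prod (Measure.pi fun _ : Fin n => μ))
      = ∫ p, F p.1 (Function.update p.1 j p.2) ∂((Measure.pi fun _ : Fin n => μ).prod μ) := by
  simp only [swapAt_singleton_fst]
  have h : MeasurePreserving (Prod.map id (Function.eval j) :
      (Fin n → 𝒳) × (Fin n → 𝒳) → (Fin n → 𝒳) × 𝒳)
      ((Measure.pi fun _ : Fin n => μ).prod (Measure.pi fun _ : Fin n => μ))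
      ((Measure.pi fun _ : Fin n => μ).prod μ) :=
    (MeasurePreserving.id _).prod (measurePreserving_eval (fun _ : Fin n => μ) j)
  exact integral_comp_of_measurePreserving h
    (F := fun p : (Fin n → 𝒳) × 𝒳 => F p.1 (Function.update p.1 j p.2))
    (hF.comp (T := fun p : (Fin n → 𝒳) × 𝒳 => (p.1, Function.update p.1 j p.2))
      (measurable_fst.prodMk (measurable_update_prod j))).measurable

/-- Two independent copies of a variable with oscillation at most `c` differ by at most `c / √2`
in `L²`: the expectation is twice a variance, to which Popoviciu's inequality applies. -/
theorem integral_sq_sub_le_of_osc {w : 𝒳 → ℝ} (hw : BddMeas w) {c : ℝ}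
    (hc : ∀ y y', |w y - w y'| ≤ c) :
    ∫ y, ∫ y', (w y - w y') ^ 2 ∂μ ∂μ ≤ c ^ 2 / 2 := by
  have hL : MemLp w 2 μ := by
    obtain ⟨C, hC⟩ := hw.bounded
    exact MemLp.of_bound hw.measurable.aestronglyMeasurable C (Filter.Eventually.of_forall hC)
  have hne : Nonempty 𝒳 := μ.nonempty_of_neZero
  have hbd : BddBelow (Set.range w) := by
    obtain ⟨C, hC⟩ := hw.bounded
    exact ⟨-C, by rintro _ ⟨y, rfl⟩; exact (abs_le.1 (hC y)).1⟩
  have hmem : ∀ y, w y ∈ Set.Icc (⨅ y, w y) ((⨅ y, w y) + c) := fun y => by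
    refine ⟨ciInf_le hbd y, ?_⟩
    have : w y - c ≤ ⨅ y, w y := le_ciInf fun y' => by linarith [(abs_le.1 (hc y y')).2]
    linarith
  have hvar := variance_le_sq_of_bounded (μ := μ) (Filter.Eventually.of_forall hmem)
    hw.measurable.aemeasurable
  rw [variance_eq_sub hL] at hvar
  have h1 (y : 𝒳) : ∫ y', (w y - w y') ^ 2 ∂μ
      = w y ^ 2 - 2 * (∫ y', w y' ∂μ) * w y + ∫ y', w y' ^ 2 ∂μ := by
    have : ∀ y', (w y - w y') ^ 2 = w y ^ 2 - 2 * w y * w y' + w y' ^ 2 := fun y' => by ring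
    simp only [this]
    rw [integral_add ((BddMeas.const _).sub (hw.const_mul _)).integrable hw.sq.integrable,
      integral_sub (integrable_const _) (hw.const_mul _).integrable, integral_const_mul]
    simp; ring
  simp only [h1]
  rw [integral_add (hw.sq.sub (hw.const_mul _)).integrable (integrable_const _),
    integral_sub hw.sq.integrable (hw.const_mul _).integrable, integral_const_mul]
  simp only [integral_const, probReal_univ, one_smul, Pi.pow_apply, add_sub_cancel_left] at hvar ⊢
  nlinarith

theorem integral_sq_sub_swapAt_le {w : (Fin n → 𝒳) → ℝ} (hw : BddMeas w) {c : ℝ} (j : Fin n)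
    (hc : ∀ x y y', |w (Function.update x j y) - w (Function.update x j y')| ≤ c) :
    ∫ z, (w z.1 - w (swapAt {(j : ℕ)} z).1) ^ 2
        ∂((Measure.pi fun _ : Fin n => μ).prod (Measure.pi fun _ : Fin n => μ)) ≤ c ^ 2 / 2 := by
  have hK : BddMeas (fun p : (Fin n → 𝒳) × 𝒳 => (w p.1 - w (Function.update p.1 j p.2)) ^ 2) :=
    ((hw.comp measurable_fst).sub (hw.comp (measurable_update_prod j))).sq
  rw [integral_swapAt_singleton_eq (F := fun x x' => (w x - w x') ^ 2) μ
    ((hw.comp measurable_fst).sub (hw.comp measurable_snd)).sq j,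
    integral_prod _ hK.integrable]
  have hK2 := BddMeas.integral_right (K := fun x y => (w x - w (Function.update x j y)) ^ 2)
    (ν := μ) hK
  rw [← integral_integral_update μ hK2 j]
  simp only [Function.update_idem]
  have hin (x : Fin n → 𝒳) :
      ∫ y, ∫ y', (w (Function.update x j y) - w (Function.update x j y')) ^ 2 ∂μ ∂μ
        ≤ c ^ 2 / 2 :=
    integral_sq_sub_le_of_osc (w := fun y => w (Function.update x j y)) μ
      (hw.comp (measurable_update x)) (hc x)
  have := integral_mono (μ := Measure.pi fun _ : Fin n => μ)
    (BddMeas.integral_right (ν := μ)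
      (K := fun x y => ∫ y', (w (Function.update x j y) - w (Function.update x j y')) ^ 2 ∂μ)
      (by simpa only [Function.update_idem] using
        hK2.comp (measurable_update_prod (𝒳 := 𝒳) j))).integrable
    (integrable_const (c ^ 2 / 2)) hin
  simpa using this

/-- The Efron–Stein inequality for functions with bounded differences. -/
theorem variance_pi_le_of_osc {w : (Fin n → 𝒳) → ℝ} (hw : BddMeas w) {c : ℝ}
    (hc : ∀ j x y y', |w (Function.update x j y) - w (Function.update x j y')| ≤ c) :
    variance w (Measure.pi fun _ : Fin n => μ) ≤ n * c ^ 2 / 4 := by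
  refine (variance_pi_le μ hw).trans ?_
  have : ∀ i ∈ Finset.range n, (1 / 2) * ∫ z, (w z.1 - w (swapAt {i} z).1) ^ 2
      ∂((Measure.pi fun _ : Fin n => μ).prod (Measure.pi fun _ : Fin n => μ)) ≤ c ^ 2 / 4 := by
    intro i hi
    have := integral_sq_sub_swapAt_le μ hw ⟨i, by simpa using hi⟩ (hc _)
    simp only at this
    linarith
  refine (Finset.sum_le_sum this).trans ?_
  rw [Finset.sum_const, Finset.card_range, nsmul_eq_mul]
  apply le_of_eq; ring

end Resample

/-! ### Stein's equation for Lipschitz test functions -/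

section Stein

open Filter Topology Real

theorem integrable_lipschitz_gaussianReal {h : ℝ → ℝ} (hh : LipschitzWith 1 h) :
    Integrable h (gaussianReal 0 1) := by
  have hid : Integrable (fun x : ℝ => x) (gaussianReal 0 1) :=
    (memLp_id_gaussianReal (μ := 0) (v := 1) 1).integrable (by simp)
  refine Integrable.mono' (hid.norm.add (integrable_const |h 0|))
    hh.continuous.measurable.aestronglyMeasurable (Eventually.of_forall fun x => ?_)
  have := hh.dist_le_mul x 0
  simp only [Real.dist_eq, NNReal.coe_one, one_mul, sub_zero] at this
  simp only [Pi.add_apply, Real.norm_eq_abs]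
  calc |h x| = |(h x - h 0) + h 0| := by ring_nf
    _ ≤ _ := (abs_add_le _ _).trans (by linarith)

theorem integral_abs_gaussianReal_le : ∫ x, |x| ∂(gaussianReal 0 1) ≤ 1 := by
  have hid : Integrable (fun x : ℝ => x) (gaussianReal 0 1) :=
    (memLp_id_gaussianReal (μ := 0) (v := 1) 1).integrable (by simp)
  have hsq : Integrable (fun x : ℝ => x ^ 2) (gaussianReal 0 1) :=
    (memLp_id_gaussianReal (μ := 0) (v := 1) 2).integrable_sq
  have hvar : ∫ x, x ^ 2 ∂(gaussianReal 0 1) = 1 := by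
    have h1 := variance_id_gaussianReal (μ := 0) (v := 1)
    rw [variance_eq_sub (memLp_id_gaussianReal 2)] at h1
    simpa [integral_id_gaussianReal] using h1
  have := integral_mono (μ := gaussianReal 0 1) hid.norm
    ((hsq.add (integrable_const 1)).const_mul (1 / 2)) fun x => by
      simp only [Real.norm_eq_abs, Pi.add_apply]
      nlinarith [sq_nonneg (|x| - 1), sq_abs x]
  simp only [Real.norm_eq_abs] at this
  refine this.trans ?_
  rw [integral_const_mul]
  simp only [Pi.add_apply]
  rw [integral_add hsq (integrable_const 1), hvar]
  simp; norm_num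

theorem abs_sub_integral_gaussianReal_le {h : ℝ → ℝ} (hh : LipschitzWith 1 h) (x : ℝ) :
    |h x - ∫ z, h z ∂(gaussianReal 0 1)| ≤ |x| + 1 := by
  have hid : Integrable (fun x : ℝ => x) (gaussianReal 0 1) :=
    (memLp_id_gaussianReal (μ := 0) (v := 1) 1).integrable (by simp)
  have hi := integrable_lipschitz_gaussianReal hh
  have h1 : h x - ∫ z, h z ∂(gaussianReal 0 1) = ∫ z, (h x - h z) ∂(gaussianReal 0 1) := by
    rw [integral_sub (integrable_const _) hi]; simp
  rw [h1]
  refine (abs_integral_le_integral_abs).trans ?_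
  have h2 := integral_mono (μ := gaussianReal 0 1) (((integrable_const (h x)).sub hi).norm)
    ((integrable_const |x|).add hid.norm) fun z => by
      have := hh.dist_le_mul x z
      simp only [Real.dist_eq, NNReal.coe_one, one_mul] at this
      simpa [Real.norm_eq_abs] using this.trans (abs_sub _ _)
  simp only [Pi.add_apply] at h2
  rw [integral_add (integrable_const _) hid.norm] at h2
  simp only [Real.norm_eq_abs, Pi.sub_apply] at h2
  have := integral_abs_gaussianReal_le
  simp only [integral_const, probReal_univ, one_smul] at h2
  linarith

theorem tendsto_abs_mul_exp_neg_sq :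
    Tendsto (fun x : ℝ => (|x| + 1) * exp (-x ^ 2 / 2)) (cocompact ℝ) (𝓝 0) := by
  have h1 := tendsto_rpow_abs_mul_exp_neg_mul_sq_cocompact (a := 1 / 2) (by norm_num) 1
  have h0 := tendsto_rpow_abs_mul_exp_neg_mul_sq_cocompact (a := 1 / 2) (by norm_num) 0
  have := h1.add h0
  simp only [rpow_one, rpow_zero, add_zero] at this
  refine this.congr fun x => ?_
  rw [show -x ^ 2 / 2 = -(1 / 2) * x ^ 2 by ring]; ring

theorem tendsto_exp_mul_of_linear_growth {g : ℝ → ℝ} {C : ℝ} (hg : ∀ x, |g x| ≤ C * (|x| + 1)) :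
    Tendsto (fun x => exp (-x ^ 2 / 2) * g x) atTop (𝓝 0) := by
  have h := (tendsto_abs_mul_exp_neg_sq.mono_left atTop_le_cocompact).const_mul C
  rw [mul_zero] at h
  refine squeeze_zero_norm (fun x => ?_) h
  rw [norm_mul, Real.norm_eq_abs, Real.norm_eq_abs, abs_of_pos (exp_pos _)]
  nlinarith [hg x, exp_pos (-x ^ 2 / 2)]

/-- A comparison principle for the first order operator `ψ ↦ ψ' - x ψ` on a half-line: a
supersolution `m` dominates a solution that grows slowly. -/
theorem le_of_stein_supersolution {ψ q m m' : ℝ → ℝ} {w : ℝ}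
    (hψ : ∀ x, w ≤ x → HasDerivAt ψ (x * ψ x + q x) x)
    (hm : ∀ x, w ≤ x → HasDerivAt m (m' x) x)
    (hq : ∀ x, w ≤ x → m' x - x * m x ≤ q x)
    (hlim : Tendsto (fun x => exp (-x ^ 2 / 2) * (ψ x - m x)) atTop (𝓝 0)) : ψ w ≤ m w := by
  have hd : ∀ x, w ≤ x → HasDerivAt (fun x => exp (-x ^ 2 / 2) * (ψ x - m x))
      (exp (-x ^ 2 / 2) * (q x - (m' x - x * m x))) x := fun x hx => by
    have h1 : HasDerivAt (fun x : ℝ => exp (-x ^ 2 / 2)) (exp (-x ^ 2 / 2) * (-x)) x := by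
      have : HasDerivAt (fun x : ℝ => -x ^ 2 / 2) (-x) x := by
        have := ((hasDerivAt_pow 2 x).neg).div_const 2
        refine HasDerivAt.congr_deriv (this) ?_; simp; ring
      exact this.exp
    refine HasDerivAt.congr_deriv (h1.mul ((hψ x hx).sub (hm x hx))) ?_
    ring
  have hmono : MonotoneOn (fun x => exp (-x ^ 2 / 2) * (ψ x - m x)) (Set.Ici w) := by
    refine monotoneOn_of_deriv_nonneg (convex_Ici w)
      (fun x hx => (hd x hx).continuousAt.continuousWithinAt)
      (fun x hx => (hd x (interior_subset hx)).differentiableAt.differentiableWithinAt)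
      fun x hx => ?_
    have hx' : w ≤ x := interior_subset hx
    rw [(hd x hx').deriv]
    exact mul_nonneg (exp_pos _).le (by linarith [hq x hx'])
  have hle : exp (-w ^ 2 / 2) * (ψ w - m w) ≤ 0 :=
    ge_of_tendsto hlim ((eventually_ge_atTop w).mono fun x hx => hmono Set.self_mem_Ici hx hx)
  by_contra! hlt
  exact absurd hle (not_le.2 (mul_pos (exp_pos _) (by linarith)))

/-- The maximum principle for `φ'' - x φ' - φ`, made to work on the whole line by the perturbation
`ε (2 + x²)`, which is a supersolution. -/
theorem le_one_of_stein_second_order {φ ψ r : ℝ → ℝ} {C : ℝ} (hφ : ∀ x, HasDerivAt φ (ψ x) x)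
    (hψ : ∀ x, HasDerivAt ψ (φ x + x * ψ x + r x) x) (hr : ∀ x, -1 ≤ r x)
    (hC : ∀ x, φ x ≤ C) (w : ℝ) : φ w ≤ 1 := by
  by_contra! hw
  obtain ⟨ε, hε, hεw⟩ : ∃ ε > 0, ε * (2 + w ^ 2) < φ w - 1 := by
    refine ⟨(φ w - 1) / (2 * (2 + w ^ 2)), by have := sub_pos.2 hw; positivity, ?_⟩
    rw [div_mul_eq_mul_div, div_lt_iff₀ (by positivity)]
    nlinarith [sq_nonneg w, mul_pos (sub_pos.2 hw) (show 0 < 2 + w ^ 2 by positivity)]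
  set D : ℝ → ℝ := fun x => φ x - 1 - ε * (2 + x ^ 2) with hD
  have hD1 : ∀ x, HasDerivAt D (ψ x - 2 * ε * x) x := fun x => by
    have := ((hφ x).sub_const 1).sub (((hasDerivAt_pow 2 x).const_add 2).const_mul ε)
    refine HasDerivAt.congr_deriv (this) ?_; simp; ring
  have hD2 : ∀ x, HasDerivAt (fun x => ψ x - 2 * ε * x)
      (φ x + x * ψ x + r x - 2 * ε) x := fun x => by
    have := (hψ x).sub ((hasDerivAt_id x).const_mul (2 * ε))
    refine HasDerivAt.congr_deriv (this) ?_; simp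
  have hcont : Continuous D := continuous_iff_continuousAt.2 fun x => (hD1 x).continuousAt
  have hev : ∀ᶠ x in cocompact ℝ, D x ≤ D w := by
    have h2 : Tendsto (fun x : ℝ => ‖x‖) (cocompact ℝ) atTop := tendsto_norm_cocompact_atTop
    have h3 := h2.eventually_ge_atTop (1 + (C - 1 - D w) / ε)
    have h4 := h2.eventually_ge_atTop 1
    filter_upwards [h3, h4] with x hx hx1
    rw [Real.norm_eq_abs] at hx hx1
    have h5 : (C - 1 - D w) / ε ≤ |x| := by linarith
    rw [div_le_iff₀ hε] at h5
    have h6 : |x| ≤ x ^ 2 := by rw [← sq_abs]; nlinarith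
    have := hC x
    simp only [hD] at h5 ⊢
    nlinarith [mul_le_mul_of_nonneg_left h6 hε.le]
  obtain ⟨x, hx⟩ := hcont.exists_forall_ge' w hev
  have hloc : IsLocalMax D x := Eventually.of_forall hx
  have h0 : ψ x - 2 * ε * x = 0 := hloc.hasDerivAt_eq_zero (hD1 x)
  have hderiv : deriv D = fun x => ψ x - 2 * ε * x := funext fun x => (hD1 x).deriv
  have hpos : 0 < deriv (deriv D) x := by
    rw [hderiv, (hD2 x).deriv]
    have h7 : D w ≤ D x := hx w
    simp only [hD] at h7
    have h8 : ψ x = 2 * ε * x := by linarith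
    rw [h8]
    nlinarith [hr x, mul_nonneg hε.le (sq_nonneg x)]
  have hmin := isLocalMin_of_deriv_deriv_pos hpos (by rw [hderiv]; exact h0)
    hcont.continuousAt
  -- a point that is both a local minimum and a local maximum has a locally constant neighbourhood
  have hconst : D =ᶠ[𝓝 x] fun _ => D x := by
    filter_upwards [hloc, hmin] with y h1 h2 using le_antisymm h1 h2
  have := hconst.deriv.deriv_eq
  simp at this
  linarith

/-- Bounds on the derivative of the Stein solution on the right half-line, from the comparison
functions `2 / x` and `3 / (x + 1)`. -/
theorem le_of_stein_bounded_rhs {ψ q : ℝ → ℝ} {C : ℝ}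
    (hψ : ∀ x, HasDerivAt ψ (x * ψ x + q x) x) (hq : ∀ x, -2 ≤ q x)
    (hC : ∀ x, |ψ x| ≤ C * (|x| + 1)) {w : ℝ} (hw : 0 ≤ w) :
    w * ψ w ≤ 2 ∧ ψ w ≤ 3 / (w + 1) := by
  have hlim (m : ℝ → ℝ) (D : ℝ) (hm : ∀ x, w ≤ x → |m x| ≤ D) :
      Tendsto (fun x => exp (-x ^ 2 / 2) * (ψ x - m x)) atTop (𝓝 0) := by
    have h1 := tendsto_exp_mul_of_linear_growth hC
    have h2 : Tendsto (fun x => exp (-x ^ 2 / 2) * D) atTop (𝓝 0) :=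
      tendsto_exp_mul_of_linear_growth (g := fun _ => D) (C := |D|) fun x => by
        nlinarith [abs_nonneg x, abs_nonneg D]
    have h3 : Tendsto (fun x => exp (-x ^ 2 / 2) * m x) atTop (𝓝 0) := by
      refine squeeze_zero_norm' ?_ h2
      filter_upwards [eventually_ge_atTop w] with x hx
      rw [norm_mul, Real.norm_eq_abs, Real.norm_eq_abs, abs_of_pos (exp_pos _)]
      exact mul_le_mul_of_nonneg_left (hm x hx) (exp_pos _).le
    simpa [mul_sub] using h1.sub h3
  constructor
  · rcases hw.eq_or_lt with rfl | hw
    · simp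
    have h := le_of_stein_supersolution (ψ := ψ) (q := q) (m := fun x => 2 / x)
      (m' := fun x => -2 / x ^ 2) (w := w) (fun x _ => hψ x)
      (fun x hx => by
        have := (hasDerivAt_inv (hw.trans_le hx).ne').const_mul 2
        simpa [div_eq_mul_inv] using this)
      (fun x hx => by
        have hx0 : 0 < x := hw.trans_le hx
        have h1 : x * (2 / x) = 2 := by field_simp
        have h2 : -2 / x ^ 2 ≤ 0 := div_nonpos_of_nonpos_of_nonneg (by norm_num) (by positivity)
        simp only [h1]
        linarith [hq x])
      (hlim _ (2 / w) fun x hx => by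
        have hx0 : 0 < x := hw.trans_le hx
        rw [abs_of_pos (by positivity)]
        exact div_le_div_of_nonneg_left (by norm_num) hw hx)
    rw [le_div_iff₀ hw] at h
    linarith
  · refine le_of_stein_supersolution (ψ := ψ) (q := q) (m := fun x => 3 / (x + 1))
      (m' := fun x => -3 / (x + 1) ^ 2) (w := w) (fun x _ => hψ x)
      (fun x hx => ?_) (fun x hx => ?_) (hlim _ 3 fun x hx => ?_)
    · have hx0 : x + 1 ≠ 0 := by linarith
      have := (((hasDerivAt_id x).add_const 1).inv hx0).const_mul 3
      simpa [div_eq_mul_inv] using this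
    · have hx0 : 0 < x + 1 := by linarith
      have h1 : -3 / (x + 1) ^ 2 - x * (3 / (x + 1)) = -(3 * x ^ 2 + 3 * x + 3) / (x + 1) ^ 2 := by
        field_simp; ring
      refine le_trans ?_ (hq x)
      rw [h1, div_le_iff₀ (by positivity)]
      nlinarith [sq_nonneg (x - 1), sq_nonneg x]
    · have hx0 : 0 ≤ x := hw.trans hx
      rw [abs_of_pos (by positivity), div_le_iff₀ (by positivity)]
      linarith

/-- Two-sided bounds on the whole line, by applying the one-sided bounds to `± ψ (± x)`. -/
theorem abs_le_of_stein_bounded_rhs {ψ q : ℝ → ℝ} {C : ℝ}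
    (hψ : ∀ x, HasDerivAt ψ (x * ψ x + q x) x) (hq : ∀ x, |q x| ≤ 2)
    (hC : ∀ x, |ψ x| ≤ C * (|x| + 1)) (w : ℝ) :
    |w * ψ w| ≤ 2 ∧ |ψ w| ≤ 3 / (|w| + 1) := by
  have key {ψ q : ℝ → ℝ} (hψ : ∀ x, HasDerivAt ψ (x * ψ x + q x) x) (hq : ∀ x, |q x| ≤ 2)
      (hC : ∀ x, |ψ x| ≤ C * (|x| + 1)) {w : ℝ} (hw : 0 ≤ w) :
      |w * ψ w| ≤ 2 ∧ |ψ w| ≤ 3 / (|w| + 1) := by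
    have h1 := le_of_stein_bounded_rhs hψ (fun x => (abs_le.1 (hq x)).1) hC hw
    have h2 := le_of_stein_bounded_rhs (ψ := fun x => -ψ x) (q := fun x => -q x)
      (fun x => by refine HasDerivAt.congr_deriv ((hψ x).neg) ?_; ring)
      (fun x => by linarith [(abs_le.1 (hq x)).2]) (C := C) (fun x => by simpa using hC x) hw
    rw [abs_of_nonneg hw]
    exact ⟨abs_le.2 ⟨by linarith [h2.1], h1.1⟩, abs_le.2 ⟨by linarith [h2.2], h1.2⟩⟩
  rcases le_total 0 w with hw | hw
  · exact key hψ hq hC hw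
  · have := key (ψ := fun x => ψ (-x)) (q := fun x => -q (-x)) (w := -w)
      (fun x => by
        have := (hψ (-x)).comp x (hasDerivAt_neg x)
        refine HasDerivAt.congr_deriv (this) ?_; ring)
      (fun x => by simpa using hq (-x)) (fun x => by simpa using hC (-x)) (by linarith)
    simpa using this

theorem abs_sub_sub_le_of_deriv_lipschitz {φ ψ ψ' : ℝ → ℝ} {L : ℝ}
    (hφ : ∀ x, HasDerivAt φ (ψ x) x) (hψ : ∀ x, HasDerivAt ψ (ψ' x) x) (hL : ∀ x, |ψ' x| ≤ 2 * L)
    (x y : ℝ) : |φ y - φ x - ψ x * (y - x)| ≤ L * (y - x) ^ 2 := by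
  have key {φ ψ ψ' : ℝ → ℝ} (hφ : ∀ x, HasDerivAt φ (ψ x) x)
      (hψ : ∀ x, HasDerivAt ψ (ψ' x) x) (hL : ∀ x, ψ' x ≤ 2 * L) (x y : ℝ) :
      φ y - φ x - ψ x * (y - x) ≤ L * (y - x) ^ 2 := by
    have hmono : Monotone fun t => 2 * L * t - ψ t := by
      have hd (t : ℝ) : HasDerivAt (fun t => 2 * L * t - ψ t) (2 * L - ψ' t) t := by
        refine HasDerivAt.congr_deriv (((hasDerivAt_id t).const_mul (2 * L)).sub (hψ t)) ?_
        simp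
      exact monotone_of_deriv_nonneg (fun t => (hd t).differentiableAt) fun t => by
        rw [(hd t).deriv]; linarith [hL t]
    have hconv : ConvexOn ℝ Set.univ fun t => L * t ^ 2 - φ t := by
      have hd (t : ℝ) : HasDerivAt (fun t => L * t ^ 2 - φ t) (2 * L * t - ψ t) t := by
        have := ((hasDerivAt_pow 2 t).const_mul L).sub (hφ t)
        refine HasDerivAt.congr_deriv (this) ?_; simp; ring
      refine Monotone.convexOn_univ_of_deriv (fun t => (hd t).differentiableAt) ?_
      rwa [show deriv (fun t => L * t ^ 2 - φ t) = fun t => 2 * L * t - ψ t from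
        funext fun t => (hd t).deriv]
    have hd : HasDerivAt (fun t => L * t ^ 2 - φ t) (2 * L * x - ψ x) x := by
      have := ((hasDerivAt_pow 2 x).const_mul L).sub (hφ x)
      refine HasDerivAt.congr_deriv (this) ?_; simp; ring
    have : (2 * L * x - ψ x) * (y - x) ≤ (L * y ^ 2 - φ y) - (L * x ^ 2 - φ x) := by
      rcases lt_trichotomy x y with hxy | rfl | hxy
      · have := hconv.le_slope_of_hasDerivAt (Set.mem_univ x) (Set.mem_univ y) hxy hd
        rwa [slope_def_field, le_div_iff₀ (by linarith)] at this
      · simp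
      · have := hconv.slope_le_of_hasDerivAt (Set.mem_univ y) (Set.mem_univ x) hxy hd
        rw [slope_def_field, div_le_iff₀ (by linarith)] at this
        linarith
    nlinarith
  refine abs_le.2 ⟨?_, key hφ hψ (fun x => (abs_le.1 (hL x)).2) x y⟩
  have := key (φ := fun x => -φ x) (fun x => (hφ x).neg) (fun x => (hψ x).neg)
    (fun x => by linarith [(abs_le.1 (hL x)).1]) x y
  linarith

/-- The bounded solution of the Stein equation for a differentiable test function with derivative
bounded by `1`, with the bounds `‖φ'‖ ≤ 2` and `‖φ''‖ ≤ 4`; the latter is expressed by the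
second order Taylor bound. -/
theorem exists_stein_solution {h h' : ℝ → ℝ} (hd : ∀ x, HasDerivAt h (h' x) x)
    (hb : ∀ x, |h' x| ≤ 1) :
    ∃ φ ψ : ℝ → ℝ, Continuous φ ∧ Continuous ψ ∧
      (∀ x, ψ x - x * φ x = h x - ∫ z, h z ∂(gaussianReal 0 1)) ∧ (∀ x, |ψ x| ≤ 2) ∧
      ∀ x y, |φ y - φ x - ψ x * (y - x)| ≤ 2 * (y - x) ^ 2 := by
  have hlip : LipschitzWith 1 h := lipschitzWith_of_nnnorm_deriv_le
    (fun x => (hd x).differentiableAt) fun x => by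
      rw [(hd x).deriv, ← NNReal.coe_le_coe]; simpa using hb x
  set k : ℝ → ℝ := fun x => h x - ∫ z, h z ∂(gaussianReal 0 1) with hk
  have hkb : ∀ x, |k x| ≤ |x| + 1 := abs_sub_integral_gaussianReal_le hlip
  have hkc : Continuous k := hlip.continuous.sub continuous_const
  have hkd : ∀ x, HasDerivAt k (h' x) x := fun x => (hd x).sub_const _
  set g : ℝ → ℝ := fun x => k x * exp (-x ^ 2 / 2) with hg
  have hgc : Continuous g := hkc.mul (by fun_prop)
  have hgi : Integrable g := by
    have h1 := (integrable_mul_exp_neg_mul_sq (b := 1 / 2) (by norm_num)).norm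
    have h2 := integrable_exp_neg_mul_sq (b := 1 / 2) (by norm_num)
    refine (h1.add h2).mono' hgc.aestronglyMeasurable (Eventually.of_forall fun x => ?_)
    simp only [hg, norm_mul, Pi.add_apply, Real.norm_eq_abs, abs_exp]
    rw [show -x ^ 2 / 2 = -(1 / 2) * x ^ 2 by ring]
    nlinarith [hkb x, exp_pos (-(1 / 2) * x ^ 2)]
  have hg0 : ∫ x, g x = 0 := by
    have h1 : ∫ x, k x ∂(gaussianReal 0 1) = 0 := by
      rw [integral_sub (integrable_lipschitz_gaussianReal hlip) (integrable_const _)]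
      simp
    rw [integral_gaussianReal_eq_integral_smul (by simp)] at h1
    have h2 : ∀ x, gaussianPDFReal 0 1 x • k x = (√(2 * π))⁻¹ * g x := fun x => by
      simp only [gaussianPDFReal, hg, smul_eq_mul, NNReal.coe_one, sub_zero, mul_one]
      ring
    simp only [h2, integral_const_mul] at h1
    exact (mul_eq_zero.1 h1).resolve_left (by positivity)
  set G : ℝ → ℝ := fun w => (∫ x in Set.Iic 0, g x) + ∫ x in (0 : ℝ)..w, g x with hG
  have hGd : ∀ w, HasDerivAt G (g w) w := fun w =>
    (hgc.integral_hasStrictDerivAt 0 w).hasDerivAt.const_add _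
  have hGtop : Tendsto G atTop (𝓝 0) := by
    have := (intervalIntegral_tendsto_integral_Ioi 0 hgi.integrableOn tendsto_id).const_add
      (∫ x in Set.Iic 0, g x)
    rwa [intervalIntegral.integral_Iic_add_Ioi hgi.integrableOn hgi.integrableOn, hg0] at this
  have hGbot : Tendsto G atBot (𝓝 0) := by
    have := (intervalIntegral_tendsto_integral_Iic 0 hgi.integrableOn tendsto_id).const_sub
      (∫ x in Set.Iic 0, g x)
    rw [sub_self] at this
    refine this.congr fun w => ?_
    simp only [hG, id]
    rw [intervalIntegral.integral_symm w 0]; ring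
  set φ : ℝ → ℝ := fun w => exp (w ^ 2 / 2) * G w with hφ
  have hexp : ∀ x : ℝ, exp (-x ^ 2 / 2) * exp (x ^ 2 / 2) = 1 := fun x => by
    rw [← exp_add]; ring_nf; simp
  have hφd : ∀ w, HasDerivAt φ (w * φ w + k w) w := fun w => by
    have h1 : HasDerivAt (fun x : ℝ => exp (x ^ 2 / 2)) (exp (w ^ 2 / 2) * w) w := by
      have : HasDerivAt (fun x : ℝ => x ^ 2 / 2) w w := by
        have := (hasDerivAt_pow 2 w).div_const 2
        refine HasDerivAt.congr_deriv (this) ?_; simp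
      exact this.exp
    refine HasDerivAt.congr_deriv (h1.mul (hGd w)) ?_
    simp only [hφ, hg]
    linear_combination (k w) * hexp w
  have hφc : Continuous φ := continuous_iff_continuousAt.2 fun x => (hφd x).continuousAt
  -- away from `[-1, 1]` the solution is bounded by comparison with the constant `2`
  have htail : ∀ {φ k : ℝ → ℝ}, (∀ w, HasDerivAt φ (w * φ w + k w) w) →
      (∀ x, |k x| ≤ |x| + 1) → Tendsto (fun x => exp (-x ^ 2 / 2) * φ x) atTop (𝓝 0) →
      ∀ w, 1 ≤ w → φ w ≤ 2 := by
    intro φ k hφ hk hlim w hw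
    refine le_of_stein_supersolution (m := fun _ => 2) (m' := fun _ => 0) (w := w)
      (fun x _ => hφ x) (fun x _ => hasDerivAt_const x 2) (fun x hx => ?_) ?_
    · have := (abs_le.1 (hk x)).1
      rw [abs_of_nonneg (by linarith)] at this
      linarith
    · have h1 : Tendsto (fun x : ℝ => exp (-x ^ 2 / 2) * 2) atTop (𝓝 0) :=
        tendsto_exp_mul_of_linear_growth (g := fun _ => 2) (C := 2) fun x => by
          have := abs_nonneg x; norm_num
      simpa [mul_sub] using hlim.sub h1
  have hφG : ∀ x, exp (-x ^ 2 / 2) * φ x = G x := fun x => by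
    simp only [hφ]; rw [← mul_assoc, hexp, one_mul]
  have hlimtop : Tendsto (fun x => exp (-x ^ 2 / 2) * φ x) atTop (𝓝 0) := by simpa only [hφG]
  have hlimbot : Tendsto (fun x => exp (-x ^ 2 / 2) * φ (-x)) atTop (𝓝 0) := by
    have := hGbot.comp tendsto_neg_atTop_atBot
    refine this.congr fun x => ?_
    rw [Function.comp_apply, ← hφG (-x)]; simp
  have hφbdd : ∃ C, ∀ x, |φ x| ≤ C := by
    obtain ⟨C, hC⟩ := (isCompact_Icc (a := (-1 : ℝ)) (b := 1)).exists_bound_of_continuousOn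
      hφc.continuousOn
    refine ⟨max C 2, fun x => ?_⟩
    have hneg : ∀ x, HasDerivAt (fun x => -φ x) (x * -φ x + -k x) x := fun x => by
      refine HasDerivAt.congr_deriv ((hφd x).neg) ?_; ring
    have hrefl : ∀ x, HasDerivAt (fun x => φ (-x)) (x * φ (-x) + -k (-x)) x := fun x => by
      refine HasDerivAt.congr_deriv ((hφd (-x)).comp x (hasDerivAt_neg x)) ?_; ring
    have hneg' : ∀ x, HasDerivAt (fun x => -φ (-x)) (x * -φ (-x) + k (-x)) x := fun x => by
      refine HasDerivAt.congr_deriv ((hrefl x).neg) ?_; ring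
    rcases le_total 1 x with hx | hx
    · refine le_trans (abs_le.2 ⟨?_, htail hφd hkb hlimtop x hx⟩) (le_max_right _ _)
      have := htail hneg (fun x => by simpa using hkb x) (by simpa using hlimtop.neg) x hx
      linarith
    rcases le_total (-1) x with hx' | hx'
    · exact (hC x ⟨hx', hx⟩).trans (le_max_left _ _)
    · have h1 := htail hrefl (fun x => by simpa using hkb (-x)) hlimbot (-x) (by linarith)
      have h2 := htail hneg' (fun x => by simpa using hkb (-x)) (by simpa using hlimbot.neg)
        (-x) (by linarith)
      simp only [neg_neg] at h1 h2
      exact le_trans (abs_le.2 ⟨by linarith, h1⟩) (le_max_right _ _)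
  obtain ⟨C, hC⟩ := hφbdd
  set ψ : ℝ → ℝ := fun w => w * φ w + k w with hψ
  have hψd : ∀ w, HasDerivAt ψ (φ w + w * ψ w + h' w) w := fun w => by
    refine HasDerivAt.congr_deriv (((hasDerivAt_id w).mul (hφd w)).add (hkd w)) ?_
    simp only [hψ, id]; ring
  have hφ1 : ∀ w, |φ w| ≤ 1 := fun w => by
    refine abs_le.2 ⟨?_, le_one_of_stein_second_order hφd hψd
      (fun x => (abs_le.1 (hb x)).1) (fun x => (abs_le.1 (hC x)).2) w⟩
    have := le_one_of_stein_second_order (φ := fun x => -φ x) (ψ := fun x => -ψ x)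
      (r := fun x => -h' x) (C := C) (fun x => (hφd x).neg)
      (fun x => by refine HasDerivAt.congr_deriv ((hψd x).neg) ?_; ring)
      (fun x => by linarith [(abs_le.1 (hb x)).2]) (fun x => by linarith [(abs_le.1 (hC x)).1]) w
    linarith
  have hψC : ∀ x, |ψ x| ≤ 2 * (|x| + 1) := fun x => by
    calc |ψ x| ≤ |x * φ x| + |k x| := abs_add_le _ _
      _ ≤ |x| * 1 + (|x| + 1) := by
        rw [abs_mul]
        exact add_le_add (mul_le_mul_of_nonneg_left (hφ1 x) (abs_nonneg _)) (hkb x)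
      _ ≤ _ := by linarith
  have hq : ∀ x, |φ x + h' x| ≤ 2 := fun x =>
    (abs_add_le _ _).trans (by linarith [hφ1 x, hb x])
  -- differentiating Stein's equation shows that `ψ = φ'` solves one with bounded right-hand side
  have hψb := abs_le_of_stein_bounded_rhs (ψ := ψ) (q := fun x => φ x + h' x) (C := 2)
    (fun x => by refine HasDerivAt.congr_deriv (hψd x) ?_; ring) hq hψC
  refine ⟨φ, ψ, hφc, (continuous_id.mul hφc).add hkc, fun x => by simp only [hψ]; ring,
    fun x => ?_, fun x y => abs_sub_sub_le_of_deriv_lipschitz hφd hψd (fun w => ?_) x y⟩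
  -- near the origin Stein's equation itself bounds `ψ`, elsewhere the comparison function does
  · rcases le_total |x| (1 / 2) with hx | hx
    · calc |ψ x| ≤ |x * φ x| + |k x| := abs_add_le _ _
        _ ≤ |x| * 1 + (|x| + 1) := by
          rw [abs_mul]
          exact add_le_add (mul_le_mul_of_nonneg_left (hφ1 x) (abs_nonneg _)) (hkb x)
        _ ≤ 2 := by linarith
    · refine (hψb x).2.trans ?_
      rw [div_le_iff₀ (by positivity)]
      linarith
  · rw [show φ w + w * ψ w + h' w = w * ψ w + (φ w + h' w) by ring]
    exact (abs_add_le _ _).trans (by linarith [(hψb w).1, hq w])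

/-- A Lipschitz function is a uniform limit of differentiable ones with the same Lipschitz
constant, namely of its averages over short intervals. -/
theorem exists_differentiable_approx {h : ℝ → ℝ} (hh : LipschitzWith 1 h) {ε : ℝ} (hε : 0 < ε) :
    ∃ g g' : ℝ → ℝ, (∀ x, HasDerivAt g (g' x) x) ∧ (∀ x, |g' x| ≤ 1) ∧ ∀ x, |g x - h x| ≤ ε := by
  have hab : ∀ x y, |h x - h y| ≤ |x - y| := fun x y => by
    simpa [Real.dist_eq] using hh.dist_le_mul x y
  set H : ℝ → ℝ := fun x => ∫ t in (0 : ℝ)..x, h t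
  have hH : ∀ x, HasDerivAt H (h x) x := fun x =>
    (hh.continuous.integral_hasStrictDerivAt 0 x).hasDerivAt
  refine ⟨fun x => (H (x + ε) - H x) / ε, fun x => (h (x + ε) - h x) / ε, fun x => ?_,
    fun x => ?_, fun x => ?_⟩
  · exact (((hH (x + ε)).comp_add_const x ε).sub (hH x)).div_const ε
  · rw [abs_div, abs_of_pos hε, div_le_one hε]
    simpa [abs_of_pos hε] using hab (x + ε) x
  · obtain ⟨c, hc, hc'⟩ := exists_hasDerivAt_eq_slope H h (show x < x + ε by linarith)
      (continuous_iff_continuousAt.2 fun y => (hH y).continuousAt).continuousOn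
      fun y _ => hH y
    simp only [add_sub_cancel_left] at hc'
    simp only [← hc']
    refine (hab c x).trans (abs_le.2 ⟨?_, ?_⟩) <;> linarith [hc.1, hc.2]

end Stein

/-! ### Normal approximation -/

section NormalApprox

variable {𝒳 : Type*} {n : ℕ}

theorem swapAt_update_of_mem {A : Finset ℕ} {k : Fin n} (hk : (k : ℕ) ∈ A) (x x' : Fin n → 𝒳)
    (y : 𝒳) : (swapAt A (Function.update x k y, x')).1 = (swapAt A (x, x')).1 := by
  ext i
  by_cases h : i = k
  · subst h; simp [swapAt, hk]
  · simp [swapAt, h]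

theorem swapAt_update_of_notMem {A : Finset ℕ} {k : Fin n} (hk : (k : ℕ) ∉ A)
    (x x' : Fin n → 𝒳) (y : 𝒳) :
    (swapAt A (Function.update x k y, x')).1 = Function.update (swapAt A (x, x')).1 k y := by
  ext i
  by_cases h : i = k
  · subst h; simp [swapAt, hk]
  · simp [swapAt, h]

theorem swapAt_singleton_swapAt_range (j : Fin n) (x x' : Fin n → 𝒳) :
    (swapAt {(j : ℕ)} (swapAt (Finset.range j) (x, x'))).1
      = Function.update (swapAt (Finset.range j) (x, x')).1 j (x' j) := by
  rw [swapAt_singleton_fst]; simp [swapAt]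

/-- The product of a first order difference of `g` at `z.1` with the same difference at the point
whose first `j` coordinates are taken from `z.2`. Half the sum over `j` of its expectations is the
variance of `g`. -/
def crossDiff (g : (Fin n → 𝒳) → ℝ) (j : ℕ) (z : (Fin n → 𝒳) × (Fin n → 𝒳)) : ℝ :=
  (g z.1 - g (swapAt {j} z).1) *
    (g (swapAt (Finset.range j) z).1 - g (swapAt {j} (swapAt (Finset.range j) z)).1)

theorem abs_mul_sub_mul_le {A A' B B' α d e : ℝ} (hA : |A| ≤ α) (hB : |B'| ≤ α)
    (hd : |A - A'| ≤ d) (he : |B - B'| ≤ e) : |A * B - A' * B'| ≤ α * d + α * e := by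
  have hα : 0 ≤ α := (abs_nonneg _).trans hA
  have h : A * B - A' * B' = A * (B - B') + B' * (A - A') := by ring
  rw [h]
  refine (abs_add_le _ _).trans ?_
  rw [abs_mul, abs_mul, add_comm]
  exact add_le_add (mul_le_mul hB hd (abs_nonneg _) hα) (mul_le_mul hA he (abs_nonneg _) hα)

theorem abs_sub_update_le {g : (Fin n → 𝒳) → ℝ} {α : ℝ}
    (hα : ∀ j x y y', |g (Function.update x j y) - g (Function.update x j y')| ≤ α)
    (j : Fin n) (x : Fin n → 𝒳) (y : 𝒳) : |g x - g (Function.update x j y)| ≤ α := by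
  simpa using hα j x (x j) y

/-- A first order difference changes by at most the bound on the mixed second differences when a
different coordinate is modified. -/
theorem abs_diff_update_sub_le {g : (Fin n → 𝒳) → ℝ} {β : ℝ}
    (hβ : ∀ l k, l ≠ k → ∀ x z z' y y', |partialDiff l z z' (partialDiff k y y' g) x| ≤ β)
    {j k : Fin n} (hjk : j ≠ k) (x : Fin n → 𝒳) (y y' t : 𝒳) :
    |(g (Function.update x k y) - g (Function.update (Function.update x k y) j t))
      - (g (Function.update x k y') - g (Function.update (Function.update x k y') j t))| ≤ β := by
  have := hβ k j hjk.symm x y y' (x j) t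
  have h (w : 𝒳) : Function.update (Function.update x k w) j (x j) = Function.update x k w := by
    rw [Function.update_comm hjk.symm, Function.update_eq_self]
  simpa only [partialDiff, h] using this

theorem abs_crossDiff_update_sub_le {g : (Fin n → 𝒳) → ℝ} {α β : ℝ} (hβ0 : 0 ≤ β)
    (hα : ∀ j x y y', |g (Function.update x j y) - g (Function.update x j y')| ≤ α)
    (hβ : ∀ l k, l ≠ k → ∀ x z z' y y', |partialDiff l z z' (partialDiff k y y' g) x| ≤ β)
    (j k : Fin n) (x x' : Fin n → 𝒳) (y y' : 𝒳) :
    |crossDiff g j (Function.update x k y, x') - crossDiff g j (Function.update x k y', x')|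
      ≤ if j = k then 2 * α ^ 2 else 2 * (α * β) := by
  have hα0 : 0 ≤ α := (abs_nonneg _).trans (hα j x y y)
  simp only [crossDiff, swapAt_singleton_swapAt_range]
  simp only [swapAt_singleton_fst]
  split_ifs with hjk
  · subst hjk
    have hj : (j : ℕ) ∉ Finset.range j := by simp
    simp only [swapAt_update_of_notMem hj, Function.update_idem]
    refine (abs_mul_sub_mul_le (hα _ _ _ _) (hα _ _ _ _) (d := α) (e := α) ?_ ?_).trans
      (by linarith)
    · simpa using hα j x y y'
    · simpa using hα j _ y y'
  · refine (abs_mul_sub_mul_le (abs_sub_update_le hα _ _ _) (abs_sub_update_le hα _ _ _)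
      (d := β) (e := β) (abs_diff_update_sub_le hβ hjk x y y' _) ?_).trans (by linarith)
    by_cases hk : (k : ℕ) ∈ Finset.range j
    · simpa only [swapAt_update_of_mem hk, sub_self, abs_zero] using hβ0
    · simp only [swapAt_update_of_notMem hk]
      exact abs_diff_update_sub_le hβ hjk _ y y' _

variable [MeasurableSpace 𝒳]

theorem bddMeas_crossDiff {g : (Fin n → 𝒳) → ℝ} (hg : BddMeas g) (j : ℕ) :
    BddMeas (crossDiff g j) := by
  have hs (A : Finset ℕ) := measurable_swapAt (n := n) (𝒳 := 𝒳) A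
  have hU : BddMeas (fun z : (Fin n → 𝒳) × (Fin n → 𝒳) => g z.1) := hg.comp measurable_fst
  exact (hU.sub (hU.comp (hs _))).mul ((hU.comp (hs _)).sub ((hU.comp (hs _)).comp (hs _)))

variable (μ : Measure 𝒳) [IsProbabilityMeasure μ]

theorem abs_integral_le_of_abs_le {α : Type*} [MeasurableSpace α] {ν : Measure α}
    [IsProbabilityMeasure ν] {u : α → ℝ} {C : ℝ} (h : ∀ x, |u x| ≤ C) : |∫ x, u x ∂ν| ≤ C := by
  simpa using norm_integral_le_of_norm_le_const (μ := ν) (f := u) (Filter.Eventually.of_forall h)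

theorem abs_integral_sub_integral_le {α : Type*} [MeasurableSpace α] {ν : Measure α}
    [IsProbabilityMeasure ν] {u v : α → ℝ} {C : ℝ} (hu : Integrable u ν) (hv : Integrable v ν)
    (h : ∀ x, |u x - v x| ≤ C) : |∫ x, u x ∂ν - ∫ x, v x ∂ν| ≤ C := by
  rw [← integral_sub hu hv]
  exact abs_integral_le_of_abs_le h

theorem integral_abs_sub_integral_le_sqrt_variance {α : Type*} [MeasurableSpace α]
    {ν : Measure α} [IsProbabilityMeasure ν] {τ : α → ℝ} (hτ : BddMeas τ) :
    ∫ x, |τ x - ∫ y, τ y ∂ν| ∂ν ≤ √(variance τ ν) := by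
  have hd : BddMeas (fun x => τ x - ∫ y, τ y ∂ν) := hτ.sub (BddMeas.const _)
  refine Real.le_sqrt_of_sq_le ?_
  have hL : MemLp (fun x => |τ x - ∫ y, τ y ∂ν|) 2 ν := by
    obtain ⟨C, hC⟩ := hd.abs.bounded
    exact MemLp.of_bound hd.abs.measurable.aestronglyMeasurable C (Filter.Eventually.of_forall hC)
  have h := variance_nonneg (fun x => |τ x - ∫ y, τ y ∂ν|) ν
  rw [variance_eq_sub hL] at h
  rw [variance_eq_integral hτ.measurable.aemeasurable]
  simp only [Pi.pow_apply, sq_abs] at h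
  linarith

/-- Normal approximation of a standardized `g`. Stein's equation reduces the claim to comparing
`E[g φ(g)]` with `E[φ'(g)]`. Telescoping writes the former as `E[φ'(g) T]` up to a Taylor error,
where `T` is half the sum of the `crossDiff`s; `T` has mean one, and the conditional
expectation of `T` given the first sample has small variance because its differences are small. -/
theorem abs_integral_sub_gaussian_le_of_standardized {g : (Fin n → 𝒳) → ℝ} (hg : BddMeas g)
    (h0 : ∫ x, g x ∂(Measure.pi fun _ : Fin n => μ) = 0)
    (h1 : ∫ x, g x ^ 2 ∂(Measure.pi fun _ : Fin n => μ) = 1) {α β : ℝ}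
    (hα0 : 0 ≤ α) (hβ0 : 0 ≤ β)
    (hα : ∀ j x y y', |g (Function.update x j y) - g (Function.update x j y')| ≤ α)
    (hβ : ∀ l k, l ≠ k → ∀ x z z' y y', |partialDiff l z z' (partialDiff k y y' g) x| ≤ β)
    {h h' : ℝ → ℝ} (hd : ∀ x, HasDerivAt h (h' x) x) (hb : ∀ x, |h' x| ≤ 1) :
    |(∫ x, h (g x) ∂(Measure.pi fun _ : Fin n => μ)) - ∫ z, h z ∂(gaussianReal 0 1)|
      ≤ √n * (α ^ 2 + n * (α * β)) + n * α ^ 3 / 2 := by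
  obtain ⟨φ, ψ, hφc, hψc, hst, hψ2, htay⟩ := exists_stein_solution hd hb
  have hhc : Continuous h := continuous_iff_continuousAt.2 fun x => (hd x).continuousAt
  set π : Measure (Fin n → 𝒳) := Measure.pi fun _ : Fin n => μ with hπ
  set ρ : Measure ((Fin n → 𝒳) × (Fin n → 𝒳)) := π.prod π with hρ
  have hs (A : Finset ℕ) := measurable_swapAt (n := n) (𝒳 := 𝒳) A
  have hU : BddMeas (fun z : (Fin n → 𝒳) × (Fin n → 𝒳) => g z.1) := hg.comp measurable_fst
  have hF := hU.continuous_comp hφc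
  have hP := hU.continuous_comp hψc
  have hT := fun j => bddMeas_crossDiff hg j
  set T : (Fin n → 𝒳) × (Fin n → 𝒳) → ℝ := fun z =>
    ∑ j ∈ Finset.range n, (1 / 2) * crossDiff g j z with hTdef
  have hTb : BddMeas T := BddMeas.sum _ fun j _ => (hT j).const_mul _
  -- `T` has mean one
  have hT1 : ∫ z, T z ∂ρ = 1 := by
    have h := integral_mul_sub_integral_mul_swapAt μ hU hU n
    simp only [swapAt_range_self, ← pow_two] at h
    rw [integral_comp_fst (u := fun x => g x ^ 2) μ hg.sq.measurable, h1,
      integral_fst_mul_snd, h0] at h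
    rw [integral_finsetSum _ fun j _ => ((hT j).const_mul _).integrable]
    simp only [integral_const_mul]
    simp only [crossDiff]
    rw [← h]; norm_num
  -- the covariance expansion of `E[g φ(g)]`
  have hcov : ∫ z, φ (g z.1) * g z.1 ∂ρ = ∑ i ∈ Finset.range n, (1 / 2) *
      ∫ z, (φ (g z.1) - φ (g (swapAt {i} z).1)) * (g (swapAt (Finset.range i) z).1
        - g (swapAt {i} (swapAt (Finset.range i) z)).1) ∂ρ := by
    rw [← integral_mul_sub_integral_mul_swapAt μ hF hU n]
    simp only [swapAt_range_self]
    rw [integral_prod_mul (fun x => φ (g x)) g, h0, mul_zero, sub_zero]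
  have hterm : ∀ i ∈ Finset.range n,
      |(1 / 2) * (∫ z, (φ (g z.1) - φ (g (swapAt {i} z).1)) * (g (swapAt (Finset.range i) z).1
        - g (swapAt {i} (swapAt (Finset.range i) z)).1) ∂ρ)
        - (1 / 2) * ∫ z, ψ (g z.1) * crossDiff g i z ∂ρ| ≤ α ^ 3 / 2 := by
    intro i hi
    obtain ⟨i, rfl⟩ : ∃ j : Fin n, (j : ℕ) = i := ⟨⟨i, Finset.mem_range.1 hi⟩, rfl⟩
    have hL : BddMeas fun z : (Fin n → 𝒳) × (Fin n → 𝒳) =>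
        (φ (g z.1) - φ (g (swapAt {(i : ℕ)} z).1)) * (g (swapAt (Finset.range i) z).1
        - g (swapAt {(i : ℕ)} (swapAt (Finset.range i) z)).1) :=
      (hF.sub (hF.comp (hs _))).mul ((hU.comp (hs _)).sub ((hU.comp (hs _)).comp (hs _)))
    have hR := hP.mul (hT i)
    have hQ : BddMeas fun z : (Fin n → 𝒳) × (Fin n → 𝒳) =>
        (g z.1 - g (swapAt {(i : ℕ)} z).1) ^ 2 := (hU.sub (hU.comp (hs _))).sq
    rw [← mul_sub, ← integral_sub hL.integrable hR.integrable, abs_mul]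
    have hpt : ∀ z : (Fin n → 𝒳) × (Fin n → 𝒳),
        |(φ (g z.1) - φ (g (swapAt {(i : ℕ)} z).1)) * (g (swapAt (Finset.range i) z).1
        - g (swapAt {(i : ℕ)} (swapAt (Finset.range i) z)).1) - ψ (g z.1) * crossDiff g i z|
        ≤ 2 * α * (g z.1 - g (swapAt {(i : ℕ)} z).1) ^ 2 := fun z => by
      have hA := htay (g z.1) (g (swapAt {(i : ℕ)} z).1)
      have hB : |g (swapAt (Finset.range i) z).1
          - g (swapAt {(i : ℕ)} (swapAt (Finset.range i) z)).1| ≤ α := by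
        rw [swapAt_singleton_swapAt_range (x := z.1) (x' := z.2)]
        exact abs_sub_update_le hα _ _ _
      have he : (φ (g z.1) - φ (g (swapAt {(i : ℕ)} z).1)) * (g (swapAt (Finset.range i) z).1
          - g (swapAt {(i : ℕ)} (swapAt (Finset.range i) z)).1) - ψ (g z.1) * crossDiff g i z
          = -((φ (g (swapAt {(i : ℕ)} z).1) - φ (g z.1)
            - ψ (g z.1) * (g (swapAt {(i : ℕ)} z).1 - g z.1)) * (g (swapAt (Finset.range i) z).1
          - g (swapAt {(i : ℕ)} (swapAt (Finset.range i) z)).1)) := by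
        simp only [crossDiff]; ring
      rw [he, abs_neg, abs_mul]
      refine (mul_le_mul hA hB (abs_nonneg _) (by positivity)).trans (le_of_eq (by ring))
    have h3 := (abs_integral_le_integral_abs (μ := ρ)).trans
      (integral_mono (hL.sub hR).abs.integrable (hQ.const_mul (2 * α)).integrable hpt)
    rw [integral_const_mul] at h3
    have h4 := integral_sq_sub_swapAt_le μ hg i (hα i)
    have h5 : 2 * α * ∫ z, (g z.1 - g (swapAt {(i : ℕ)} z).1) ^ 2 ∂ρ ≤ 2 * α * (α ^ 2 / 2) :=
      mul_le_mul_of_nonneg_left h4 (by positivity)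
    rw [abs_of_pos (by norm_num : (0 : ℝ) < 1 / 2)]
    linarith
  have hPT : ∫ z, ψ (g z.1) * T z ∂ρ
      = ∑ i ∈ Finset.range n, (1 / 2) * ∫ z, ψ (g z.1) * crossDiff g i z ∂ρ := by
    simp only [← integral_const_mul]
    rw [← integral_finsetSum _ fun i _ => ((hP.mul (hT i)).const_mul _).integrable]
    refine integral_congr_ae (Filter.Eventually.of_forall fun z => ?_)
    simp only [hTdef, Finset.mul_sum]
    exact Finset.sum_congr rfl fun i _ => by ring
  have hmain1 : |∫ z, φ (g z.1) * g z.1 ∂ρ - ∫ z, ψ (g z.1) * T z ∂ρ| ≤ n * α ^ 3 / 2 := by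
    rw [hcov, hPT, ← Finset.sum_sub_distrib]
    refine (Finset.abs_sum_le_sum_abs _ _).trans ((Finset.sum_le_sum hterm).trans ?_)
    rw [Finset.sum_const, Finset.card_range, nsmul_eq_mul]
    apply le_of_eq; ring
  -- the conditional expectation of `T` given the first sample
  set τ : (Fin n → 𝒳) → ℝ := fun x => ∫ x', T (x, x') ∂π with hτ
  have hτb : BddMeas τ := BddMeas.integral_right (K := fun x x' => T (x, x')) hTb
  have hτ1 : ∫ x, τ x ∂π = 1 := by
    rw [← hT1, integral_prod _ hTb.integrable]
  have hPτ : ∫ z, ψ (g z.1) * T z ∂ρ = ∫ x, ψ (g x) * τ x ∂π := by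
    rw [integral_prod _ (hP.mul hTb).integrable]
    simp only [integral_const_mul, hτ]
  have hosc : ∀ k x y y', |τ (Function.update x k y) - τ (Function.update x k y')|
      ≤ α ^ 2 + n * (α * β) := by
    intro k x y y'
    have hsl (x : Fin n → 𝒳) : BddMeas fun x' => T (x, x') := hTb.comp (by fun_prop)
    simp only [hτ]
    rw [← integral_sub (hsl _).integrable (hsl _).integrable]
    have hpt : ∀ x', |T (Function.update x k y, x') - T (Function.update x k y', x')|
        ≤ α ^ 2 + n * (α * β) := fun x' => by
      simp only [hTdef]
      rw [← Finset.sum_sub_distrib, Finset.sum_range]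
      refine (Finset.abs_sum_le_sum_abs _ _).trans ?_
      have hle : ∀ j ∈ (Finset.univ : Finset (Fin n)),
          |1 / 2 * crossDiff g j (Function.update x k y, x')
            - 1 / 2 * crossDiff g j (Function.update x k y', x')|
          ≤ (if j = k then α ^ 2 else 0) + α * β := fun j _ => by
        have := abs_crossDiff_update_sub_le hβ0 hα hβ j k x x' y y'
        rw [← mul_sub, abs_mul, abs_of_pos (by norm_num : (0 : ℝ) < 1 / 2)]
        have := mul_nonneg hα0 hβ0
        split_ifs at * <;> linarith
      refine (Finset.sum_le_sum hle).trans ?_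
      rw [Finset.sum_add_distrib]
      simp
    exact abs_integral_le_of_abs_le hpt
  have hc0 : 0 ≤ α ^ 2 + n * (α * β) := by positivity
  have hvar : √(variance τ π) ≤ √n * (α ^ 2 + n * (α * β)) / 2 := by
    refine (Real.sqrt_le_sqrt (variance_pi_le_of_osc μ hτb hosc)).trans (le_of_eq ?_)
    rw [show (n : ℝ) * (α ^ 2 + n * (α * β)) ^ 2 / 4
      = n * ((α ^ 2 + n * (α * β)) / 2) ^ 2 by ring, Real.sqrt_mul (by positivity),
      Real.sqrt_sq (by positivity)]
    ring
  have hmain2 : |∫ x, ψ (g x) * τ x ∂π - ∫ x, ψ (g x) ∂π| ≤ √n * (α ^ 2 + n * (α * β)) := by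
    have hψg := hg.continuous_comp hψc
    have hdτ : BddMeas fun x => τ x - 1 := hτb.sub (BddMeas.const 1)
    rw [← integral_sub (hψg.mul hτb).integrable hψg.integrable]
    have h2 := (abs_integral_le_integral_abs (μ := π)).trans
      (integral_mono ((hψg.mul hτb).sub hψg).abs.integrable (hdτ.abs.const_mul 2).integrable
        fun x => by
          rw [show ψ (g x) * τ x - ψ (g x) = ψ (g x) * (τ x - 1) by ring, abs_mul]
          exact mul_le_mul_of_nonneg_right (hψ2 _) (abs_nonneg _))
    rw [integral_const_mul] at h2
    have h3 := integral_abs_sub_integral_le_sqrt_variance (ν := π) hτb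
    rw [hτ1] at h3
    linarith
  have hφg := hg.continuous_comp hφc
  have hstein : (∫ x, h (g x) ∂π) - ∫ z, h z ∂(gaussianReal 0 1)
      = (∫ x, ψ (g x) ∂π) - ∫ x, φ (g x) * g x ∂π := by
    rw [← integral_sub (hg.continuous_comp hψc).integrable (hφg.mul hg).integrable]
    have : ∀ x, ψ (g x) - φ (g x) * g x = h (g x) - ∫ z, h z ∂(gaussianReal 0 1) := fun x => by
      rw [← hst, mul_comm]
    simp only [this]
    rw [integral_sub (hg.continuous_comp hhc).integrable (integrable_const _)]
    simp
  rw [integral_comp_fst (u := fun x => φ (g x) * g x) μ (hφg.mul hg).measurable, hPτ] at hmain1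
  rw [hstein]
  have h5 := abs_le.1 hmain1
  have h6 := abs_le.1 hmain2
  exact abs_le.2 ⟨by linarith, by linarith⟩

/-- Normal approximation for functions with small first and mixed second differences. -/
theorem abs_integral_sub_gaussian_le {f : (Fin n → 𝒳) → ℝ} (hf : BddMeas f) {α β : ℝ}
    (hα0 : 0 ≤ α) (hβ0 : 0 ≤ β)
    (hα : ∀ j x y y', |f (Function.update x j y) - f (Function.update x j y')| ≤ α)
    (hβ : ∀ l k, l ≠ k → ∀ x z z' y y', |partialDiff l z z' (partialDiff k y y' f) x| ≤ β)
    (hσ : 0 < variance f (Measure.pi fun _ : Fin n => μ)) {h : ℝ → ℝ} (hh : LipschitzWith 1 h) :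
    |(∫ x, h ((f x - ∫ y, f y ∂(Measure.pi fun _ : Fin n => μ))
        / √(variance f (Measure.pi fun _ : Fin n => μ))) ∂(Measure.pi fun _ : Fin n => μ))
        - ∫ z, h z ∂(gaussianReal 0 1)|
      ≤ √n * (α ^ 2 + n * (α * β)) / variance f (Measure.pi fun _ : Fin n => μ)
        + n * α ^ 3 / (2 * √(variance f (Measure.pi fun _ : Fin n => μ)) ^ 3) := by
  set π : Measure (Fin n → 𝒳) := Measure.pi fun _ : Fin n => μ
  set s : ℝ := √(variance f π) with hs
  set m : ℝ := ∫ y, f y ∂π with hm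
  have hs0 : 0 < s := Real.sqrt_pos.2 hσ
  have hs2 : s ^ 2 = variance f π := Real.sq_sqrt hσ.le
  have hg : BddMeas fun x => (f x - m) / s := by
    simpa [div_eq_inv_mul] using (hf.sub (BddMeas.const m)).const_mul s⁻¹
  have h0 : ∫ x, (f x - m) / s ∂π = 0 := by
    rw [integral_div, integral_sub hf.integrable (integrable_const _)]
    simp [hm]
  have h1 : ∫ x, ((f x - m) / s) ^ 2 ∂π = 1 := by
    simp only [div_pow]
    rw [integral_div, hs2, variance_eq_integral hf.measurable.aemeasurable, div_self]
    rw [← variance_eq_integral hf.measurable.aemeasurable]; exact hσ.ne'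
  have hα' : ∀ j x y y', |(f (Function.update x j y) - m) / s
      - (f (Function.update x j y') - m) / s| ≤ α / s := fun j x y y' => by
    rw [← sub_div, abs_div, abs_of_pos hs0]
    refine div_le_div_of_nonneg_right ?_ hs0.le
    simpa using hα j x y y'
  have hβ' : ∀ l k, l ≠ k → ∀ x z z' y y',
      |partialDiff l z z' (partialDiff k y y' fun x => (f x - m) / s) x| ≤ β / s := by
    intro l k hlk x z z' y y'
    have : partialDiff l z z' (partialDiff k y y' fun x => (f x - m) / s) x
        = partialDiff l z z' (partialDiff k y y' f) x / s := by
      simp only [partialDiff]; ring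
    rw [this, abs_div, abs_of_pos hs0]
    exact div_le_div_of_nonneg_right (hβ l k hlk x z z' y y') hs0.le
  have hbound : √n * ((α / s) ^ 2 + n * (α / s * (β / s))) + n * (α / s) ^ 3 / 2
      = √n * (α ^ 2 + n * (α * β)) / variance f π + n * α ^ 3 / (2 * s ^ 3) := by
    rw [← hs2]; field_simp
  rw [← hbound]
  refine le_of_forall_pos_le_add fun ε hε => ?_
  obtain ⟨g, g', hgd, hg1, hgh⟩ := exists_differentiable_approx hh (half_pos hε)
  have hmain := abs_integral_sub_gaussian_le_of_standardized μ hg h0 h1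
    (div_nonneg hα0 hs0.le) (div_nonneg hβ0 hs0.le) hα' hβ' hgd hg1
  have hgc : Continuous g := continuous_iff_continuousAt.2 fun x => (hgd x).continuousAt
  have hglip : LipschitzWith 1 g := lipschitzWith_of_nnnorm_deriv_le
    (fun x => (hgd x).differentiableAt) fun x => by
      rw [(hgd x).deriv, ← NNReal.coe_le_coe]; simpa using hg1 x
  have ha1 := abs_le.1 (abs_integral_sub_integral_le (ν := π) (hg.continuous_comp hgc).integrable
    (hg.continuous_comp hh.continuous).integrable fun x => hgh _)
  have ha2 := abs_le.1 (abs_integral_sub_integral_le (integrable_lipschitz_gaussianReal hglip)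
    (integrable_lipschitz_gaussianReal hh) hgh)
  have ha3 := abs_le.1 hmain
  exact abs_le.2 ⟨by linarith, by linarith⟩

end NormalApprox

/-! ### Entropy of exponentials and its tensorization -/

section Entropy

open Real

variable {α β : Type*} [MeasurableSpace α] [MeasurableSpace β]

/-- The entropy `E[F log F] - E[F] log E[F]` of the positive function `F = exp g`. -/
noncomputable def entExp (ν : Measure α) (g : α → ℝ) : ℝ :=
  (∫ x, exp (g x) * g x ∂ν) - (∫ x, exp (g x) ∂ν) * log (∫ x, exp (g x) ∂ν)

theorem BddMeas.exp {g : α → ℝ} (hg : BddMeas g) : BddMeas (fun x => exp (g x)) :=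
  hg.continuous_comp continuous_exp

theorem BddMeas.exp_mul_self {g : α → ℝ} (hg : BddMeas g) :
    BddMeas (fun x => Real.exp (g x) * g x) :=
  hg.exp.mul hg

theorem integral_exp_mem_Icc {ν : Measure α} [IsProbabilityMeasure ν] {g : α → ℝ}
    (hg : BddMeas g) {C : ℝ} (hC : ∀ x, |g x| ≤ C) :
    ∫ x, exp (g x) ∂ν ∈ Set.Icc (exp (-C)) (exp C) := by
  have h1 := integral_mono (μ := ν) (integrable_const (exp (-C))) hg.exp.integrable
    fun x => exp_le_exp.2 (abs_le.1 (hC x)).1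
  have h2 := integral_mono (μ := ν) hg.exp.integrable (integrable_const (exp C))
    fun x => exp_le_exp.2 (abs_le.1 (hC x)).2
  exact ⟨by simpa using h1, by simpa using h2⟩

theorem integral_exp_comp_pos {ν : Measure α} [IsProbabilityMeasure ν] {g : α → ℝ}
    (hg : BddMeas g) : 0 < ∫ x, exp (g x) ∂ν := by
  obtain ⟨C, hC⟩ := hg.bounded
  exact (exp_pos _).trans_le (integral_exp_mem_Icc hg hC).1

theorem bddMeas_log_integral_exp {ν : Measure β} [IsProbabilityMeasure ν] {g : α → β → ℝ}
    (hg : BddMeas (fun p : α × β => g p.1 p.2)) :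
    BddMeas (fun x => log (∫ y, exp (g x y) ∂ν)) := by
  obtain ⟨C, hC⟩ := hg.bounded
  refine ⟨measurable_log.comp
    (BddMeas.integral_right (K := fun x y => exp (g x y)) (ν := ν) hg.exp).measurable, C,
    fun x => ?_⟩
  have h := integral_exp_mem_Icc (ν := ν) (hg.slice_left x) fun y => hC (x, y)
  have hpos := (exp_pos (-C)).trans_le h.1
  exact abs_le.2 ⟨(le_log_iff_exp_le hpos).2 h.1, (log_le_iff_le_exp hpos).2 h.2⟩

theorem bddMeas_entExp {ν : Measure β} [IsProbabilityMeasure ν] {g : α → β → ℝ}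
    (hg : BddMeas (fun p : α × β => g p.1 p.2)) : BddMeas (fun x => entExp ν (g x)) :=
  (BddMeas.integral_right (K := fun x y => exp (g x y) * g x y) hg.exp_mul_self).sub
    ((BddMeas.integral_right (K := fun x y => exp (g x y)) hg.exp).mul
      (bddMeas_log_integral_exp hg))

/-- Subadditivity of the entropy on a product of two spaces. With `G` and `H` the two marginals
of `F = exp g` and `M` its total mass, the difference of the two sides is the integral of
`F log (F M / (G H)) ≥ F - G H / M`. -/
theorem entExp_prod_le {μ : Measure α} {ν : Measure β} [IsProbabilityMeasure μ]
    [IsProbabilityMeasure ν] {g : α → β → ℝ} (hg : BddMeas (fun p : α × β => g p.1 p.2)) :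
    entExp (μ.prod ν) (fun p => g p.1 p.2)
      ≤ ∫ y, entExp μ (fun x => g x y) ∂ν + ∫ x, entExp ν (g x) ∂μ := by
  have hg' : BddMeas (fun p : β × α => g p.2 p.1) := hg.comp measurable_swap
  set G : β → ℝ := fun y => ∫ x, exp (g x y) ∂μ with hG
  set H : α → ℝ := fun x => ∫ y, exp (g x y) ∂ν with hH
  set M : ℝ := ∫ p, exp (g p.1 p.2) ∂(μ.prod ν) with hM
  have hGb : BddMeas G := BddMeas.integral_right (K := fun y x => exp (g x y)) hg'.exp
  have hHb : BddMeas H := BddMeas.integral_right (K := fun x y => exp (g x y)) hg.exp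
  have hGl : BddMeas (fun y => log (G y)) := bddMeas_log_integral_exp (g := fun y x => g x y) hg'
  have hHl : BddMeas (fun x => log (H x)) := bddMeas_log_integral_exp hg
  have hG0 : ∀ y, 0 < G y := fun y => integral_exp_comp_pos (hg.slice_right y)
  have hH0 : ∀ x, 0 < H x := fun x => integral_exp_comp_pos (hg.slice_left x)
  have hM0 : 0 < M := integral_exp_comp_pos hg
  have hMG : ∫ y, G y ∂ν = M := (integral_prod_symm _ hg.exp.integrable).symm
  have hMH : ∫ x, H x ∂μ = M := (integral_prod _ hg.exp.integrable).symm
  set E : ℝ := ∫ p, exp (g p.1 p.2) * g p.1 p.2 ∂(μ.prod ν) with hE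
  have e1 : ∫ y, entExp μ (fun x => g x y) ∂ν = E - ∫ y, G y * log (G y) ∂ν := by
    have hi := BddMeas.integral_right (K := fun y x => exp (g x y) * g x y) (ν := μ)
      hg'.exp_mul_self
    rw [hE, integral_prod_symm _ hg.exp_mul_self.integrable,
      ← integral_sub hi.integrable (hGb.mul hGl).integrable]
    rfl
  have e2 : ∫ x, entExp ν (g x) ∂μ = E - ∫ x, H x * log (H x) ∂μ := by
    have hi := BddMeas.integral_right (K := fun x y => exp (g x y) * g x y) (ν := ν)
      hg.exp_mul_self
    rw [hE, integral_prod _ hg.exp_mul_self.integrable,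
      ← integral_sub hi.integrable (hHb.mul hHl).integrable]
    rfl
  have hGl2 : BddMeas (fun p : α × β => log (G p.2)) := hGl.comp measurable_snd
  have hHl2 : BddMeas (fun p : α × β => log (H p.1)) := hHl.comp measurable_fst
  have e3 : ∫ p, exp (g p.1 p.2) * log (G p.2) ∂(μ.prod ν) = ∫ y, G y * log (G y) ∂ν := by
    rw [integral_prod_symm _ (hg.exp.mul hGl2).integrable]
    simp only [integral_mul_const, hG]
  have e4 : ∫ p, exp (g p.1 p.2) * log (H p.1) ∂(μ.prod ν) = ∫ x, H x * log (H x) ∂μ := by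
    rw [integral_prod _ (hg.exp.mul hHl2).integrable]
    simp only [integral_mul_const, hH]
  have hGH : BddMeas (fun p : α × β => H p.1 * G p.2) :=
    (hHb.comp measurable_fst).mul (hGb.comp measurable_snd)
  have e5 : ∫ p, H p.1 * G p.2 ∂(μ.prod ν) = M * M := by
    rw [integral_prod_mul, hMG, hMH]
  have hpt : ∀ p : α × β, exp (g p.1 p.2) - M⁻¹ * (H p.1 * G p.2)
      ≤ exp (g p.1 p.2) * g p.1 p.2 - exp (g p.1 p.2) * log (G p.2)
        - exp (g p.1 p.2) * log (H p.1) + log M * exp (g p.1 p.2) := fun p => by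
    have hGp := hG0 p.2
    have hHp := hH0 p.1
    have hF := exp_pos (g p.1 p.2)
    have h1 := one_sub_inv_le_log_of_pos (x := exp (g p.1 p.2) * M / (G p.2 * H p.1))
      (by positivity)
    rw [log_div (by positivity) (by positivity), log_mul hF.ne' hM0.ne',
      log_mul hGp.ne' hHp.ne', log_exp] at h1
    have h2 := mul_le_mul_of_nonneg_left h1 hF.le
    have h3 : exp (g p.1 p.2) * (1 - (exp (g p.1 p.2) * M / (G p.2 * H p.1))⁻¹)
        = exp (g p.1 p.2) - M⁻¹ * (H p.1 * G p.2) := by field_simp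
    rw [h3] at h2
    linarith
  have hint := integral_mono (μ := μ.prod ν) (hg.exp.sub (hGH.const_mul M⁻¹)).integrable
    (((hg.exp_mul_self.sub (hg.exp.mul hGl2)).sub (hg.exp.mul hHl2)).add
      (hg.exp.const_mul (log M))).integrable hpt
  rw [integral_sub hg.exp.integrable (hGH.const_mul M⁻¹).integrable,
    integral_add ((hg.exp_mul_self.sub (hg.exp.mul hGl2)).sub (hg.exp.mul hHl2)).integrable
      (hg.exp.const_mul (log M)).integrable,
    integral_sub (hg.exp_mul_self.sub (hg.exp.mul hGl2)).integrable
      (hg.exp.mul hHl2).integrable,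
    integral_sub hg.exp_mul_self.integrable (hg.exp.mul hGl2).integrable,
    integral_const_mul, integral_const_mul, e3, e4, e5, ← hM, ← hE,
    inv_mul_cancel_left₀ hM0.ne'] at hint
  rw [e1, e2, entExp, ← hM, ← hE]
  linarith

variable {𝒳 : Type*} [MeasurableSpace 𝒳] (μ : Measure 𝒳) [IsProbabilityMeasure μ]

theorem measurePreserving_cons (N : ℕ) :
    MeasurePreserving (fun p : 𝒳 × (Fin N → 𝒳) => (Fin.cons p.1 p.2 : Fin (N + 1) → 𝒳))
      (μ.prod (Measure.pi fun _ : Fin N => μ)) (Measure.pi fun _ : Fin (N + 1) => μ) := by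
  have := (measurePreserving_piFinSuccAbove (fun _ : Fin (N + 1) => μ) 0).symm
  convert this using 1
  ext p i
  simp [MeasurableEquiv.piFinSuccAbove, Fin.insertNthEquiv]

/-- Tensorization of the entropy: bounds on the entropies in the single coordinates add up. -/
theorem entExp_pi_le (N : ℕ) {g : (Fin N → 𝒳) → ℝ} (hg : BddMeas g)
    {R : Fin N → (Fin N → 𝒳) → ℝ} (hR : ∀ k, BddMeas (R k))
    (h : ∀ k x, entExp μ (fun y => g (Function.update x k y))
      ≤ ∫ y, R k (Function.update x k y) ∂μ) :
    entExp (Measure.pi fun _ : Fin N => μ) g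
      ≤ ∑ k, ∫ x, R k x ∂(Measure.pi fun _ : Fin N => μ) := by
  induction N with
  | zero =>
    have : ∀ x, g x = g default := fun x => by rw [Subsingleton.elim x default]
    simp only [entExp, this]
    simp [mul_comm]
  | succ N ih =>
    have hne : Nonempty 𝒳 := μ.nonempty_of_neZero
    have hmp := measurePreserving_cons μ N
    have hc : ∀ {G : (Fin (N + 1) → 𝒳) → ℝ}, BddMeas G →
        BddMeas (fun p : 𝒳 × (Fin N → 𝒳) => G (Fin.cons p.1 p.2)) :=
      fun hG => hG.comp hmp.measurable
    have hgc := hc hg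
    have h1 : entExp (Measure.pi fun _ : Fin (N + 1) => μ) g
        = entExp (μ.prod (Measure.pi fun _ : Fin N => μ)) fun p => g (Fin.cons p.1 p.2) := by
      simp only [entExp]
      rw [← integral_comp_of_measurePreserving hmp hg.exp_mul_self.measurable,
        ← integral_comp_of_measurePreserving hmp hg.exp.measurable]
    rw [h1]
    refine (entExp_prod_le (g := fun x y => g (Fin.cons x y)) hgc).trans ?_
    rw [Fin.sum_univ_succ]
    refine add_le_add ?_ ?_
    · rw [← integral_comp_of_measurePreserving hmp (hR 0).measurable,
        integral_prod_symm _ (hc (hR 0)).integrable]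
      refine integral_mono
        (bddMeas_entExp (g := fun y x => g (Fin.cons x y)) (hgc.comp measurable_swap)).integrable
        (BddMeas.integral_left (K := fun x y => R 0 (Fin.cons x y)) (hc (hR 0))).integrable
        fun y => ?_
      have := h 0 (Fin.cons (Classical.arbitrary 𝒳) y)
      simpa only [Fin.update_cons_zero] using this
    · have h2 : ∀ x, entExp (Measure.pi fun _ : Fin N => μ) (fun y => g (Fin.cons x y))
          ≤ ∑ k : Fin N, ∫ y, R k.succ (Fin.cons x y) ∂(Measure.pi fun _ : Fin N => μ) := by
        intro x
        refine ih (hgc.slice_left (K := fun x y => g (Fin.cons x y)) x)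
          (R := fun k y => R k.succ (Fin.cons x y))
          (fun k => (hc (hR k.succ)).slice_left (K := fun x y => R k.succ (Fin.cons x y)) x)
          fun k y => ?_
        have := h k.succ (Fin.cons x y)
        simpa only [← Fin.cons_update] using this
      have h3 : ∀ k : Fin N, BddMeas fun x =>
          ∫ y, R k.succ (Fin.cons x y) ∂(Measure.pi fun _ : Fin N => μ) := fun k =>
        BddMeas.integral_right (K := fun x y => R k.succ (Fin.cons x y)) (hc (hR k.succ))
      refine (integral_mono (bddMeas_entExp (g := fun x y => g (Fin.cons x y)) hgc).integrable
        (BddMeas.sum Finset.univ fun k _ => h3 k).integrable h2).trans (le_of_eq ?_)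
      rw [integral_finsetSum _ fun k _ => (h3 k).integrable]
      refine Finset.sum_congr rfl fun k _ => ?_
      rw [← integral_comp_of_measurePreserving hmp (hR k.succ).measurable,
        integral_prod _ (hc (hR k.succ)).integrable]

/-! ### An upper tail bound for weakly self-bounding functions -/

theorem exp_neg_le_quadratic {s : ℝ} (hs : 0 ≤ s) : exp (-s) ≤ 1 - s + s ^ 2 / 2 := by
  have h1 := quadratic_le_exp_of_nonneg hs
  have h2 : exp (-s) * exp s = 1 := by rw [← exp_add]; simp
  have h3 : exp (-s) * (1 + s + s ^ 2 / 2) ≤ 1 :=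
    (mul_le_mul_of_nonneg_left h1 (exp_pos _).le).trans h2.le
  have h4 : 1 ≤ (1 - s + s ^ 2 / 2) * (1 + s + s ^ 2 / 2) := by nlinarith [sq_nonneg (s ^ 2)]
  exact le_of_mul_le_mul_right (h3.trans h4) (by positivity)

/-- A modified logarithmic Sobolev inequality in one coordinate, where `w` bounds how much `v`
can be decreased. -/
theorem entExp_le_of_decrease_le {v w : 𝒳 → ℝ} (hv : BddMeas v) (hw : BddMeas w)
    (hvw : ∀ y y', v y - v y' ≤ w y) {t : ℝ} (ht : 0 ≤ t) :
    entExp μ (fun y => t * v y) ≤ ∫ y, t ^ 2 / 2 * (w y ^ 2 * exp (t * v y)) ∂μ := by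
  have hne : Nonempty 𝒳 := μ.nonempty_of_neZero
  have hbd : BddBelow (Set.range v) := by
    obtain ⟨C, hC⟩ := hv.bounded
    exact ⟨-C, by rintro _ ⟨y, rfl⟩; exact (abs_le.1 (hC y)).1⟩
  set i : ℝ := ⨅ y, v y with hi
  have hi1 : ∀ y, i ≤ v y := fun y => ciInf_le hbd y
  have hi2 : ∀ y, v y - i ≤ w y := fun y => by
    have : v y - w y ≤ i := le_ciInf fun y' => by linarith [hvw y y']
    linarith
  have htv : BddMeas fun y => t * v y := hv.const_mul t
  have hM := integral_exp_comp_pos (ν := μ) htv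
  set M : ℝ := ∫ y, exp (t * v y) ∂μ with hMdef
  -- the entropy is at most the corresponding expression with a constant in place of the mean
  have h1 : t * i * M - exp (t * i) + M ≤ M * log M := by
    have := one_sub_inv_le_log_of_pos (x := M / exp (t * i)) (by positivity)
    rw [log_div hM.ne' (exp_pos _).ne', log_exp] at this
    have h2 := mul_le_mul_of_nonneg_left this hM.le
    have h3 : M * (1 - (M / exp (t * i))⁻¹) = M - exp (t * i) := by field_simp
    rw [h3] at h2
    linarith
  have hpt : ∀ y, exp (t * v y) * (t * v y) - t * i * exp (t * v y) + exp (t * i) - exp (t * v y)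
      ≤ t ^ 2 / 2 * (w y ^ 2 * exp (t * v y)) := fun y => by
    have hs : 0 ≤ t * (v y - i) := mul_nonneg ht (sub_nonneg.2 (hi1 y))
    have h2 := exp_neg_le_quadratic hs
    have h3 : exp (t * i) = exp (t * v y) * exp (-(t * (v y - i))) := by
      rw [← exp_add]; ring_nf
    have h4 : (v y - i) ^ 2 ≤ w y ^ 2 := pow_le_pow_left₀ (sub_nonneg.2 (hi1 y)) (hi2 y) 2
    have h5 : (t * (v y - i)) ^ 2 ≤ t ^ 2 * w y ^ 2 := by
      rw [mul_pow]; exact mul_le_mul_of_nonneg_left h4 (sq_nonneg t)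
    have h6 := exp_pos (t * v y)
    rw [h3]
    nlinarith [mul_le_mul_of_nonneg_left h2 h6.le, mul_le_mul_of_nonneg_left h5 h6.le]
  have hint := integral_mono (μ := μ)
    (((htv.exp_mul_self.sub (htv.exp.const_mul (t * i))).add
      (BddMeas.const (exp (t * i)))).sub htv.exp).integrable
    ((hw.sq.mul htv.exp).const_mul (t ^ 2 / 2)).integrable hpt
  rw [integral_sub ((htv.exp_mul_self.sub (htv.exp.const_mul (t * i))).add
      (BddMeas.const (exp (t * i)))).integrable htv.exp.integrable,
    integral_add (htv.exp_mul_self.sub (htv.exp.const_mul (t * i))).integrable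
      (integrable_const _),
    integral_sub htv.exp_mul_self.integrable (htv.exp.const_mul (t * i)).integrable,
    integral_const_mul (t * i), ← hMdef] at hint
  refine le_trans ?_ hint
  simp only [entExp, ← hMdef, integral_const, probReal_univ, one_smul]
  linarith

/-- The entropy (Herbst) argument: if `v` is weakly self-bounding, `∑ w_k² ≤ A v`, then
`log E[exp (t v)] * (1 / t - A / 2)` is nonincreasing in `t`, and its limit at `0` is `E[v]`. -/
theorem log_integral_exp_le_of_selfBounding {N : ℕ} {v : (Fin N → 𝒳) → ℝ} (hv : BddMeas v)
    {w : Fin N → (Fin N → 𝒳) → ℝ} (hw : ∀ k, BddMeas (w k))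
    (hvw : ∀ k x y, v x - v (Function.update x k y) ≤ w k x) {A : ℝ} (hA : 0 < A)
    (hself : ∀ x, ∑ k, w k x ^ 2 ≤ A * v x) :
    log (∫ x, exp (1 / A * v x) ∂(Measure.pi fun _ : Fin N => μ))
      ≤ 2 * (∫ x, v x ∂(Measure.pi fun _ : Fin N => μ)) / A := by
  set ρ : Measure (Fin N → 𝒳) := Measure.pi fun _ : Fin N => μ with hρ
  have hset : integrableExpSet v ρ = Set.univ := by
    ext t
    simpa [integrableExpSet] using (hv.const_mul t).exp.integrable
  have hm (t : ℝ) : HasDerivAt (mgf v ρ) (∫ x, v x * exp (t * v x) ∂ρ) t :=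
    hasDerivAt_mgf (by simp [hset])
  have hm0 (t : ℝ) : 0 < mgf v ρ t := integral_exp_comp_pos (hv.const_mul t)
  have hent (t : ℝ) (ht : 0 < t) :
      t * (∫ x, v x * exp (t * v x) ∂ρ) - mgf v ρ t * log (mgf v ρ t)
        ≤ t ^ 2 * A / 2 * ∫ x, v x * exp (t * v x) ∂ρ := by
    have htv : BddMeas fun x => t * v x := hv.const_mul t
    have hR (k : Fin N) : BddMeas fun x => t ^ 2 / 2 * (w k x ^ 2 * exp (t * v x)) :=
      ((hw k).sq.mul htv.exp).const_mul _
    have h1 := entExp_pi_le μ N htv hR fun k x =>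
      entExp_le_of_decrease_le (v := fun y => v (Function.update x k y))
        (w := fun y => w k (Function.update x k y)) μ (hv.comp (measurable_update x))
        ((hw k).comp (measurable_update x))
        (fun y y' => by simpa using hvw k (Function.update x k y) y') ht.le
    rw [← integral_finsetSum _ fun k _ => (hR k).integrable] at h1
    have h2 := h1.trans (integral_mono (BddMeas.sum _ fun k _ => hR k).integrable
      ((hv.mul htv.exp).const_mul (t ^ 2 * A / 2)).integrable fun x => by
        simp only [← Finset.mul_sum, ← Finset.sum_mul]
        have := mul_le_mul_of_nonneg_right (hself x) (exp_pos (t * v x)).le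
        nlinarith [mul_le_mul_of_nonneg_left this (show 0 ≤ t ^ 2 / 2 by positivity)])
    rw [integral_const_mul] at h2
    refine le_trans (le_of_eq ?_) h2
    simp only [entExp, mgf]
    rw [← integral_const_mul]
    congr 1
    exact integral_congr_ae (Filter.Eventually.of_forall fun x => by ring)
  set L : ℝ → ℝ := fun t => log (mgf v ρ t) with hL
  have hLd (t : ℝ) : HasDerivAt L ((∫ x, v x * exp (t * v x) ∂ρ) / mgf v ρ t) t :=
    (hm t).log (hm0 t).ne'
  set u : ℝ → ℝ := fun t => L t * (t⁻¹ - A / 2) with hu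
  have hud (t : ℝ) (ht : 0 < t) : HasDerivAt u
      ((∫ x, v x * exp (t * v x) ∂ρ) / mgf v ρ t * (t⁻¹ - A / 2) + L t * (-(t ^ 2)⁻¹)) t :=
    (hLd t).mul ((hasDerivAt_inv ht.ne').sub_const (A / 2))
  have hanti : AntitoneOn u (Set.Ioi 0) := by
    refine antitoneOn_of_deriv_nonpos (convex_Ioi 0)
      (fun t ht => (hud t ht).continuousAt.continuousWithinAt)
      (fun t ht => (hud t (interior_subset ht)).differentiableAt.differentiableWithinAt)
      fun t ht => ?_
    have ht : 0 < t := interior_subset ht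
    rw [(hud t ht).deriv]
    have h1 := hent t ht
    have hM := hm0 t
    have h2 : (∫ x, v x * exp (t * v x) ∂ρ) / mgf v ρ t * (t⁻¹ - A / 2) + L t * (-(t ^ 2)⁻¹)
        = (t * (∫ x, v x * exp (t * v x) ∂ρ) - mgf v ρ t * log (mgf v ρ t)
          - t ^ 2 * A / 2 * ∫ x, v x * exp (t * v x) ∂ρ) / (t ^ 2 * mgf v ρ t) := by
      simp only [hL]; field_simp; ring_nf
    rw [h2]
    exact div_nonpos_of_nonpos_of_nonneg (by linarith) (by positivity)
  have hL0 : L 0 = 0 := by simp [hL]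
  have hlim : Filter.Tendsto u (nhdsWithin 0 (Set.Ioi 0)) (nhds (∫ x, v x ∂ρ)) := by
    have h1 := (hLd 0).tendsto_slope_zero_right
    simp only [zero_add, hL0, sub_zero, smul_eq_mul, mgf_zero, zero_mul, exp_zero, mul_one,
      div_one] at h1
    have h2 : Filter.Tendsto L (nhdsWithin 0 (Set.Ioi 0)) (nhds 0) := by
      have := (hLd 0).continuousAt.tendsto
      rw [hL0] at this
      exact this.mono_left nhdsWithin_le_nhds
    have h3 := h1.sub (h2.mul_const (A / 2))
    simp only [zero_mul, sub_zero] at h3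
    refine h3.congr fun t => ?_
    simp only [hu]; ring
  have hle : u (1 / A) ≤ ∫ x, v x ∂ρ := by
    refine ge_of_tendsto hlim ?_
    have : Set.Ioo (0 : ℝ) (1 / A) ∈ nhdsWithin 0 (Set.Ioi 0) :=
      Ioo_mem_nhdsGT (by positivity)
    filter_upwards [this] with t ht
    exact hanti ht.1 (show (0 : ℝ) < 1 / A by positivity) ht.2.le
  have hu1 : u (1 / A) = L (1 / A) * (A / 2) := by
    simp only [hu, one_div, inv_inv]; ring
  rw [hu1] at hle
  change L (1 / A) ≤ _
  rw [le_div_iff₀ hA]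
  linarith

theorem measureReal_ge_le_of_selfBounding {N : ℕ} {v : (Fin N → 𝒳) → ℝ} (hv : BddMeas v)
    {w : Fin N → (Fin N → 𝒳) → ℝ} (hw : ∀ k, BddMeas (w k))
    (hvw : ∀ k x y, v x - v (Function.update x k y) ≤ w k x) {A : ℝ} (hA : 0 < A)
    (hself : ∀ x, ∑ k, w k x ^ 2 ≤ A * v x) (V : ℝ) :
    (Measure.pi fun _ : Fin N => μ).real {x | V ≤ v x}
      ≤ exp (-((V - 2 * ∫ x, v x ∂(Measure.pi fun _ : Fin N => μ)) / A)) := by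
  set ρ : Measure (Fin N → 𝒳) := Measure.pi fun _ : Fin N => μ with hρ
  have h1 := measure_ge_le_exp_mul_mgf (μ := ρ) (X := v) V (t := 1 / A) (by positivity)
    (hv.const_mul _).exp.integrable
  have h2 := log_integral_exp_le_of_selfBounding μ hv hw hvw hA hself
  rw [log_le_iff_le_exp (integral_exp_comp_pos (hv.const_mul _))] at h2
  refine h1.trans ((mul_le_mul_of_nonneg_left h2 (exp_pos _).le).trans (le_of_eq ?_))
  rw [← exp_add]
  congr 1
  field_simp
  ring

end Entropy

/-! ### The variance estimator -/

section Estimator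

variable {𝒳 : Type*} {n : ℕ}

/-- The difference `f (S₋^j x) - f (S₋^j S^i_{x_j} x)` entering the variance estimator, where
`i = j.succAbove p` is recorded through the position `p` that it has after the deletion of `j`. -/
def deletionDiff (f : (Fin n → 𝒳) → ℝ) (j : Fin (n + 1)) (p : Fin n) (x : Fin (n + 1) → 𝒳) : ℝ :=
  f (j.removeNth x) - f (Function.update (j.removeNth x) p (x j))

theorem removeNth_update_succAbove (j : Fin (n + 1)) (p : Fin n) (x : Fin (n + 1) → 𝒳) (y : 𝒳) :
    j.removeNth (Function.update x (j.succAbove p) y) = Function.update (j.removeNth x) p y := by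
  ext i
  by_cases h : i = p
  · subst h; simp [Fin.removeNth]
  · simp [Fin.removeNth, h]

theorem varEstimator_eq (f : (Fin n → 𝒳) → ℝ) (x : Fin (n + 1) → 𝒳) :
    varEstimator f x = 1 / (2 * ((n : ℝ) + 1)) * ∑ j, ∑ p, deletionDiff f j p x ^ 2 := by
  unfold varEstimator
  congr 1
  refine Finset.sum_congr rfl fun j _ => ?_
  rw [Finset.sum_filter, Fin.sum_univ_succAbove _ j]
  simp [deletionDiff, Fin.succAbove_ne]

theorem varEstimator_nonneg (f : (Fin n → 𝒳) → ℝ) (x : Fin (n + 1) → 𝒳) :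
    0 ≤ varEstimator f x := by
  rw [varEstimator_eq]; positivity

theorem sq_deletionDiff_le {f : (Fin n → 𝒳) → ℝ} {α : ℝ}
    (hα : ∀ j x y y', |f (Function.update x j y) - f (Function.update x j y')| ≤ α)
    (j : Fin (n + 1)) (p : Fin n) (x : Fin (n + 1) → 𝒳) : deletionDiff f j p x ^ 2 ≤ α ^ 2 := by
  have h := abs_sub_update_le hα p (j.removeNth x) (x j)
  exact sq_le_sq' (abs_le.1 h).1 (abs_le.1 h).2

theorem varEstimator_le {f : (Fin n → 𝒳) → ℝ} {α : ℝ}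
    (hα : ∀ j x y y', |f (Function.update x j y) - f (Function.update x j y')| ≤ α)
    (x : Fin (n + 1) → 𝒳) : varEstimator f x ≤ n * α ^ 2 / 2 := by
  rw [varEstimator_eq]
  have h : ∑ j, ∑ p, deletionDiff f j p x ^ 2 ≤ ∑ _j : Fin (n + 1), ∑ _p : Fin n, α ^ 2 :=
    Finset.sum_le_sum fun j _ => Finset.sum_le_sum fun p _ => sq_deletionDiff_le hα j p x
  simp only [Finset.sum_const, Finset.card_univ, Fintype.card_fin, nsmul_eq_mul] at h
  refine (mul_le_mul_of_nonneg_left h (by positivity)).trans (le_of_eq ?_)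
  push_cast
  field_simp

/-- The number of the two indices `j` and `j.succAbove p` that are equal to `k`, that is, how often
the `k`-th observation plays a distinguished role in `deletionDiff f j p`. -/
def incidence (k j : Fin (n + 1)) (p : Fin n) : ℝ :=
  (if k = j then 1 else 0) + if k = j.succAbove p then 1 else 0

theorem incidence_nonneg (k j : Fin (n + 1)) (p : Fin n) : 0 ≤ incidence k j p := by
  unfold incidence; split_ifs <;> norm_num

theorem sum_incidence_left (j : Fin (n + 1)) (p : Fin n) : ∑ k, incidence k j p = 2 := by
  simp only [incidence, Finset.sum_add_distrib, Finset.sum_ite_eq', Finset.mem_univ, if_true]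
  norm_num

theorem sum_sum_incidence_right (k : Fin (n + 1)) : ∑ j, ∑ p : Fin n, incidence k j p = 2 * n := by
  have h (j : Fin (n + 1)) : ∑ p : Fin n, (if k = j.succAbove p then (1 : ℝ) else 0)
      = 1 - if k = j then 1 else 0 := by
    have := Fin.sum_univ_succAbove (fun i => if k = i then (1 : ℝ) else 0) j
    simp only [Finset.sum_ite_eq, Finset.mem_univ, if_true] at this
    linarith
  simp only [incidence, Finset.sum_add_distrib, h, Finset.sum_sub_distrib, Finset.sum_const,
    Finset.card_univ, Fintype.card_fin, nsmul_eq_mul, ← Finset.mul_sum, Finset.sum_ite_eq,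
    Finset.mem_univ, if_true]
  push_cast; ring

/-- An upper bound on the possible decrease of the variance estimator when the `k`-th observation
is modified. -/
noncomputable def decreaseBound (f : (Fin n → 𝒳) → ℝ) (β : ℝ) (k : Fin (n + 1))
    (x : Fin (n + 1) → 𝒳) : ℝ :=
  1 / (2 * ((n : ℝ) + 1)) * (∑ j, ∑ p, incidence k j p * deletionDiff f j p x ^ 2
    + 2 * β * ∑ j, ∑ p, |deletionDiff f j p x|)

theorem varEstimator_sub_update_le {f : (Fin n → 𝒳) → ℝ} {β : ℝ} (hβ0 : 0 ≤ β)
    (hβ : ∀ l k, l ≠ k → ∀ x z z' y y', |partialDiff l z z' (partialDiff k y y' f) x| ≤ β)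
    (k : Fin (n + 1)) (x : Fin (n + 1) → 𝒳) (y : 𝒳) :
    varEstimator f x - varEstimator f (Function.update x k y) ≤ decreaseBound f β k x := by
  rw [varEstimator_eq, varEstimator_eq, ← mul_sub, decreaseBound]
  refine mul_le_mul_of_nonneg_left ?_ (by positivity)
  rw [← Finset.sum_sub_distrib, Finset.mul_sum, ← Finset.sum_add_distrib]
  refine Finset.sum_le_sum fun j _ => ?_
  rw [← Finset.sum_sub_distrib, Finset.mul_sum, ← Finset.sum_add_distrib]
  refine Finset.sum_le_sum fun p _ => ?_
  have h0 : 0 ≤ 2 * β * |deletionDiff f j p x| := by positivity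
  have h1 := sq_nonneg (deletionDiff f j p x)
  have h2 := sq_nonneg (deletionDiff f j p (Function.update x k y))
  by_cases hkj : k = j
  · have : 1 ≤ incidence k j p := by
      unfold incidence; simp only [if_pos hkj]; split_ifs; all_goals norm_num
    nlinarith
  by_cases hkp : k = j.succAbove p
  · have : 1 ≤ incidence k j p := by
      unfold incidence; simp only [if_pos hkp]; split_ifs; all_goals norm_num
    nlinarith
  obtain ⟨q, rfl⟩ := Fin.exists_succAbove_eq hkj
  have hqp : p ≠ q := fun h => hkp (by rw [h])
  have hinc : incidence (j.succAbove q) j p = 0 := by simp [incidence, hkj, hkp]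
  rw [hinc]
  have hd : |deletionDiff f j p x
      - deletionDiff f j p (Function.update x (j.succAbove q) y)| ≤ β := by
    simp only [deletionDiff, removeNth_update_succAbove,
      Function.update_of_ne (Fin.ne_succAbove j q)]
    have := abs_diff_update_sub_le hβ hqp (j.removeNth x) ((j.removeNth x) q) y (x j)
    simpa using this
  set r := deletionDiff f j p x
  set r' := deletionDiff f j p (Function.update x (j.succAbove q) y)
  have h3 : r * (r - r') ≤ |r| * β :=
    (le_abs_self _).trans (by rw [abs_mul]; exact mul_le_mul_of_nonneg_left hd (abs_nonneg _))
  nlinarith [sq_nonneg (r - r')]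

/-- The variance estimator is weakly self-bounding. Each observation has a distinguished role in
`2 n` of the terms, each at most `α²`; the effect of the second differences on the remaining terms
is estimated by the Cauchy–Schwarz inequality. -/
theorem sum_sq_decreaseBound_le (hn : 1 ≤ n) {f : (Fin n → 𝒳) → ℝ} {α β : ℝ}
    (hα : ∀ j x y y', |f (Function.update x j y) - f (Function.update x j y')| ≤ α)
    (x : Fin (n + 1) → 𝒳) :
    ∑ k, decreaseBound f β k x ^ 2 ≤ (3 * α ^ 2 + 12 * n ^ 2 * β ^ 2) * varEstimator f x := by
  have hn' : (1 : ℝ) ≤ n := by exact_mod_cast hn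
  set Q : ℝ := ∑ j, ∑ p, deletionDiff f j p x ^ 2 with hQ
  set S : ℝ := ∑ j, ∑ p, |deletionDiff f j p x| with hS
  set R : Fin (n + 1) → ℝ := fun k => ∑ j, ∑ p, incidence k j p * deletionDiff f j p x ^ 2 with hR
  have hQ0 : 0 ≤ Q := by positivity
  have hR0 : ∀ k, 0 ≤ R k := fun k => Finset.sum_nonneg fun j _ => Finset.sum_nonneg fun p _ =>
    mul_nonneg (incidence_nonneg k j p) (sq_nonneg _)
  have hRle : ∀ k, R k ≤ 2 * n * α ^ 2 := fun k => by
    rw [← sum_sum_incidence_right k, Finset.sum_mul]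
    refine Finset.sum_le_sum fun j _ => ?_
    rw [Finset.sum_mul]
    exact Finset.sum_le_sum fun p _ =>
      mul_le_mul_of_nonneg_left (sq_deletionDiff_le hα j p x) (incidence_nonneg k j p)
  have hRsum : ∑ k, R k = 2 * Q := by
    simp only [hR]
    rw [Finset.sum_comm, hQ, Finset.mul_sum]
    refine Finset.sum_congr rfl fun j _ => ?_
    rw [Finset.sum_comm, Finset.mul_sum]
    refine Finset.sum_congr rfl fun p _ => ?_
    rw [← Finset.sum_mul, sum_incidence_left]
  have hRsq : ∑ k, R k ^ 2 ≤ 4 * n * α ^ 2 * Q := by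
    have : ∑ k, R k ^ 2 ≤ ∑ k, 2 * n * α ^ 2 * R k := Finset.sum_le_sum fun k _ => by
      rw [pow_two]; exact mul_le_mul_of_nonneg_right (hRle k) (hR0 k)
    rw [← Finset.mul_sum, hRsum] at this
    linarith
  have hSsq : S ^ 2 ≤ n * (n + 1) * Q := by
    have h := sq_sum_le_card_mul_sum_sq (s := (Finset.univ : Finset (Fin (n + 1) × Fin n)))
      (f := fun q => |deletionDiff f q.1 q.2 x|)
    simp only [sq_abs, Fintype.sum_prod_type, Finset.card_univ, Fintype.card_prod,
      Fintype.card_fin] at h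
    push_cast at h
    linarith
  have hle : ∀ k, decreaseBound f β k x ^ 2
      ≤ (1 / (2 * ((n : ℝ) + 1))) ^ 2 * (3 / 2 * R k ^ 2 + 12 * β ^ 2 * S ^ 2) := fun k => by
    rw [decreaseBound, mul_pow]
    refine mul_le_mul_of_nonneg_left ?_ (sq_nonneg _)
    change (R k + 2 * β * S) ^ 2 ≤ _
    -- Young's inequality `(x + y)² ≤ 3/2 x² + 3 y²`
    nlinarith [sq_nonneg (R k - 4 * β * S)]
  refine (Finset.sum_le_sum fun k _ => hle k).trans ?_
  rw [← Finset.mul_sum, Finset.sum_add_distrib, ← Finset.mul_sum, Finset.sum_const,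
    Finset.card_univ, Fintype.card_fin, nsmul_eq_mul, varEstimator_eq, ← hQ]
  push_cast
  have h1 : 3 / 2 * ∑ k, R k ^ 2 + ((n : ℝ) + 1) * (12 * β ^ 2 * S ^ 2)
      ≤ 3 / 2 * (4 * n * α ^ 2 * Q) + ((n : ℝ) + 1) * (12 * β ^ 2 * (n * (n + 1) * Q)) := by
    gcongr
  have h2 : 3 / 2 * (4 * n * α ^ 2 * Q) + ((n : ℝ) + 1) * (12 * β ^ 2 * (n * (n + 1) * Q))
      ≤ 2 * ((n : ℝ) + 1) * ((3 * α ^ 2 + 12 * n ^ 2 * β ^ 2) * Q) := by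
    have h3 : 0 ≤ α ^ 2 * Q := by positivity
    have h4 : 0 ≤ β ^ 2 * Q * n * (n + 1) * (n - 1) :=
      mul_nonneg (by positivity) (by linarith)
    nlinarith
  have hpos : (0 : ℝ) < 2 * ((n : ℝ) + 1) := by positivity
  calc (1 / (2 * ((n : ℝ) + 1))) ^ 2 * (3 / 2 * ∑ k, R k ^ 2 + ((n : ℝ) + 1) * (12 * β ^ 2 * S ^ 2))
      ≤ (1 / (2 * ((n : ℝ) + 1))) ^ 2 *
          (2 * ((n : ℝ) + 1) * ((3 * α ^ 2 + 12 * n ^ 2 * β ^ 2) * Q)) :=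
        mul_le_mul_of_nonneg_left (h1.trans h2) (by positivity)
    _ = _ := by field_simp

variable [MeasurableSpace 𝒳]

theorem measurable_removeNth (j : Fin (n + 1)) :
    Measurable (fun x : Fin (n + 1) → 𝒳 => j.removeNth x) :=
  measurable_pi_lambda _ fun _ => measurable_pi_apply _

theorem bddMeas_deletionDiff {f : (Fin n → 𝒳) → ℝ} (hf : BddMeas f) (j : Fin (n + 1))
    (p : Fin n) : BddMeas (deletionDiff f j p) :=
  (hf.comp (measurable_removeNth j)).sub (hf.comp (T := fun x : Fin (n + 1) → 𝒳 =>
    Function.update (j.removeNth x) p (x j)) ((measurable_update_prod p).comp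
      ((measurable_removeNth j).prodMk (measurable_pi_apply j))))

theorem bddMeas_varEstimator {f : (Fin n → 𝒳) → ℝ} (hf : BddMeas f) :
    BddMeas (varEstimator f) := by
  have : varEstimator f = fun x =>
      1 / (2 * ((n : ℝ) + 1)) * ∑ j, ∑ p, deletionDiff f j p x ^ 2 := funext (varEstimator_eq f)
  rw [this]
  exact (BddMeas.sum _ fun j _ => BddMeas.sum _ fun p _ =>
    (bddMeas_deletionDiff hf j p).sq).const_mul _

theorem bddMeas_decreaseBound {f : (Fin n → 𝒳) → ℝ} (hf : BddMeas f) (β : ℝ)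
    (k : Fin (n + 1)) : BddMeas (decreaseBound f β k) :=
  ((BddMeas.sum _ fun j _ => BddMeas.sum _ fun p _ =>
    (bddMeas_deletionDiff hf j p).sq.const_mul _).add ((BddMeas.sum _ fun j _ =>
      BddMeas.sum _ fun p _ => (bddMeas_deletionDiff hf j p).abs).const_mul _)).const_mul _

variable (μ : Measure 𝒳) [IsProbabilityMeasure μ]

/-- The expectation of the variance estimator is the Efron–Stein bound. -/
theorem integral_varEstimator {f : (Fin n → 𝒳) → ℝ} (hf : BddMeas f) :
    ∫ x, varEstimator f x ∂(Measure.pi fun _ : Fin (n + 1) => μ)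
      = ∑ p ∈ Finset.range n, (1 / 2) * ∫ z, (f z.1 - f (swapAt {p} z).1) ^ 2
          ∂((Measure.pi fun _ : Fin n => μ).prod (Measure.pi fun _ : Fin n => μ)) := by
  have hK (p : Fin n) : BddMeas fun q : (Fin n → 𝒳) × 𝒳 =>
      (f q.1 - f (Function.update q.1 p q.2)) ^ 2 :=
    ((hf.comp measurable_fst).sub (hf.comp (measurable_update_prod p))).sq
  have hd (j : Fin (n + 1)) (p : Fin n) :
      ∫ x, deletionDiff f j p x ^ 2 ∂(Measure.pi fun _ : Fin (n + 1) => μ)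
        = ∫ z, (f z.1 - f (swapAt {(p : ℕ)} z).1) ^ 2
          ∂((Measure.pi fun _ : Fin n => μ).prod (Measure.pi fun _ : Fin n => μ)) := by
    rw [integral_swapAt_singleton_eq (F := fun x x' => (f x - f x') ^ 2) μ
      ((hf.comp measurable_fst).sub (hf.comp measurable_snd)).sq p]
    have h := Measure.measurePreserving_swap.comp
      (measurePreserving_piFinSuccAbove (fun _ : Fin (n + 1) => μ) j)
    exact integral_comp_of_measurePreserving h (hK p).measurable
  simp only [varEstimator_eq]
  rw [integral_const_mul, integral_finsetSum _ fun j _ =>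
    (BddMeas.sum _ fun p _ => (bddMeas_deletionDiff hf j p).sq).integrable]
  have h2 (j : Fin (n + 1)) :
      ∫ x, ∑ p, deletionDiff f j p x ^ 2 ∂(Measure.pi fun _ : Fin (n + 1) => μ)
      = ∑ p : Fin n, ∫ z, (f z.1 - f (swapAt {(p : ℕ)} z).1) ^ 2
          ∂((Measure.pi fun _ : Fin n => μ).prod (Measure.pi fun _ : Fin n => μ)) := by
    rw [integral_finsetSum _ fun p _ => (bddMeas_deletionDiff hf j p).sq.integrable]
    exact Finset.sum_congr rfl fun p _ => hd j p
  simp only [h2]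
  rw [Finset.sum_const, Finset.card_univ, Fintype.card_fin, nsmul_eq_mul, ← Finset.mul_sum,
    Finset.sum_range]
  push_cast
  field_simp

theorem integral_varEstimator_le {f : (Fin n → 𝒳) → ℝ} (hf : BddMeas f) {β : ℝ} (hβ0 : 0 ≤ β)
    (hβ : ∀ l k, l ≠ k → ∀ x z z' y y', |partialDiff l z z' (partialDiff k y y' f) x| ≤ β) :
    ∫ x, varEstimator f x ∂(Measure.pi fun _ : Fin (n + 1) => μ)
      ≤ variance f (Measure.pi fun _ : Fin n => μ) + n ^ 2 * β ^ 2 / 4 := by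
  rw [integral_varEstimator μ hf]
  refine efronStein_le_variance_add μ hf fun i j hij z => ?_
  have hout {i : ℕ} (hi : ¬ i < n) (z : (Fin n → 𝒳) × (Fin n → 𝒳)) : swapAt {i} z = z := by
    ext k <;> simp only [swapAt, Finset.mem_singleton] <;> rw [if_neg (by omega)]
  by_cases hi : i < n
  · by_cases hj : j < n
    · obtain ⟨i, rfl⟩ : ∃ k : Fin n, (k : ℕ) = i := ⟨⟨i, hi⟩, rfl⟩
      obtain ⟨j, rfl⟩ : ∃ k : Fin n, (k : ℕ) = j := ⟨⟨j, hj⟩, rfl⟩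
      have hij' : j ≠ i := fun h => hij (by rw [h])
      have h2 : (swapAt {(i : ℕ)} z).2 j = z.2 j := by
        simp [swapAt, Fin.val_inj, hij']
      have := abs_diff_update_sub_le hβ hij' z.1 (z.1 i) (z.2 i) (z.2 j)
      simp only [swapAt_singleton_fst, h2]
      simpa using this
    · simpa [hout hj] using hβ0
  · simpa [hout hi] using hβ0

end Estimator

/-! ### Transfer to the sample and conclusion -/

section Conclusion

variable {𝒳 : Type*} {n : ℕ}

theorem abs_sub_update_le_of_seminormM {f : (Fin n → 𝒳) → ℝ} (hf : ∃ C : ℝ, ∀ x, |f x| ≤ C)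
    {c : ℝ} (hc : seminormM f ≤ c) (j : Fin n) (x : Fin n → 𝒳) (y y' : 𝒳) :
    |f (Function.update x j y) - f (Function.update x j y')| ≤ c := by
  obtain ⟨C, hC⟩ := hf
  have hbdd : BddAbove {r : ℝ | ∃ (k : Fin n) (x : Fin n → 𝒳) (y y' : 𝒳),
      r = partialDiff k y y' f x} := by
    refine ⟨2 * C, ?_⟩
    rintro _ ⟨k, x, y, y', rfl⟩
    have h1 := abs_le.1 (hC (Function.update x k y))
    have h2 := abs_le.1 (hC (Function.update x k y'))
    simp only [partialDiff]; linarith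
  have h (y y' : 𝒳) : f (Function.update x j y) - f (Function.update x j y') ≤ c :=
    (le_csSup hbdd ⟨j, x, y, y', rfl⟩).trans hc
  exact abs_le.2 ⟨by linarith [h y' y], h y y'⟩

theorem abs_partialDiff_partialDiff_le_of_seminormJ (hn : 1 ≤ n) {f : (Fin n → 𝒳) → ℝ}
    (hf : ∃ C : ℝ, ∀ x, |f x| ≤ C) {b : ℝ} (hb : seminormJ f ≤ b / n) {l k : Fin n} (hlk : l ≠ k)
    (x : Fin n → 𝒳) (z z' y y' : 𝒳) :
    |partialDiff l z z' (partialDiff k y y' f) x| ≤ b / n ^ 2 := by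
  obtain ⟨C, hC⟩ := hf
  have hn' : (0 : ℝ) < n := by exact_mod_cast hn
  have hbdd : BddAbove {r : ℝ | ∃ (l k : Fin n) (x : Fin n → 𝒳) (z z' y y' : 𝒳),
      l ≠ k ∧ r = partialDiff l z z' (partialDiff k y y' f) x} := by
    refine ⟨4 * C, ?_⟩
    rintro _ ⟨l, k, x, z, z', y, y', -, rfl⟩
    simp only [partialDiff]
    have h (a c : 𝒳) := abs_le.1 (hC (Function.update (Function.update x l a) k c))
    linarith [h z y, h z y', h z' y, h z' y']
  have h (z z' : 𝒳) : partialDiff l z z' (partialDiff k y y' f) x ≤ b / n ^ 2 := by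
    refine (le_csSup hbdd ⟨l, k, x, z, z', y, y', hlk, rfl⟩).trans ?_
    unfold seminormJ at hb
    rw [pow_two, ← div_div, le_div_iff₀ hn', mul_comm]
    exact hb
  refine abs_le.2 ⟨?_, h z z'⟩
  have := h z' z
  simp only [partialDiff] at this ⊢
  linarith

variable [MeasurableSpace 𝒳] {Ω : Type*} [MeasurableSpace Ω] {P : Measure Ω}

theorem distNormal_comp_le {μ : Measure 𝒳} [IsProbabilityMeasure μ] {Y : Ω → Fin n → 𝒳}
    (hY : MeasurePreserving Y P (Measure.pi fun _ : Fin n => μ)) {f : (Fin n → 𝒳) → ℝ}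
    (hf : BddMeas f) {c : ℝ}
    (hc : ∀ h : ℝ → ℝ, LipschitzWith 1 h →
      |(∫ x, h ((f x - ∫ y, f y ∂(Measure.pi fun _ : Fin n => μ))
        / √(variance f (Measure.pi fun _ : Fin n => μ))) ∂(Measure.pi fun _ : Fin n => μ))
        - ∫ z, h z ∂(gaussianReal 0 1)| ≤ c) :
    distNormal P (fun ω => f (Y ω)) ≤ ENNReal.ofReal c := by
  refine iSup₂_le fun h hh => ENNReal.ofReal_le_ofReal ?_
  have h1 : ∫ ω, f (Y ω) ∂P = ∫ y, f y ∂(Measure.pi fun _ : Fin n => μ) :=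
    integral_comp_of_measurePreserving hY hf.measurable
  have h2 : variance (fun ω => f (Y ω)) P = variance f (Measure.pi fun _ : Fin n => μ) := by
    rw [variance_eq_integral (hf.comp hY.measurable).measurable.aemeasurable,
      variance_eq_integral hf.measurable.aemeasurable, h1]
    exact integral_comp_of_measurePreserving hY (hf.sub (BddMeas.const _)).sq.measurable
  rw [h1, h2]
  refine le_trans (le_of_eq ?_) (hc h hh)
  congr 2
  exact integral_comp_of_measurePreserving hY
    (F := fun x => h ((f x - ∫ y, f y ∂(Measure.pi fun _ : Fin n => μ))
      / √(variance f (Measure.pi fun _ : Fin n => μ))))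
    (hh.continuous.measurable.comp ((hf.measurable.sub_const _).div_const _))

/-- The distance to normality never exceeds `2`: compare both laws with the point mass at `0`. -/
theorem abs_integral_standardized_sub_gaussian_le_two {α : Type*} [MeasurableSpace α]
    {ν : Measure α} [IsProbabilityMeasure ν] {f : α → ℝ} (hf : BddMeas f) {h : ℝ → ℝ}
    (hh : LipschitzWith 1 h) :
    |(∫ x, h ((f x - ∫ y, f y ∂ν) / √(variance f ν)) ∂ν) - ∫ z, h z ∂(gaussianReal 0 1)| ≤ 2 := by
  set s := √(variance f ν)
  have hs : 0 ≤ s := Real.sqrt_nonneg _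
  have hg : BddMeas fun x => (f x - ∫ y, f y ∂ν) / s := by
    simpa [div_eq_inv_mul] using (hf.sub (BddMeas.const (∫ y, f y ∂ν))).const_mul s⁻¹
  have h1 : ∫ x, |(f x - ∫ y, f y ∂ν) / s| ∂ν ≤ 1 := by
    simp only [abs_div, abs_of_nonneg hs]
    rw [integral_div]
    exact div_le_one_of_le₀ (integral_abs_sub_integral_le_sqrt_variance hf) hs
  have h2 : |(∫ x, h ((f x - ∫ y, f y ∂ν) / s) ∂ν) - h 0| ≤ 1 := by
    have h3 : (∫ x, h ((f x - ∫ y, f y ∂ν) / s) ∂ν) - h 0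
        = ∫ x, (h ((f x - ∫ y, f y ∂ν) / s) - h 0) ∂ν := by
      rw [integral_sub (hg.continuous_comp hh.continuous).integrable (integrable_const _)]
      simp
    rw [h3]
    refine abs_integral_le_integral_abs.trans (le_trans ?_ h1)
    refine integral_mono ((hg.continuous_comp hh.continuous).sub (BddMeas.const _)).abs.integrable
      hg.abs.integrable fun x => ?_
    have := hh.dist_le_mul ((f x - ∫ y, f y ∂ν) / s) 0
    rwa [Real.dist_eq, Real.dist_eq, NNReal.coe_one, one_mul, sub_zero] at this
  have h4 := abs_sub_integral_gaussianReal_le hh 0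
  rw [abs_zero, zero_add] at h4
  exact (abs_sub_le _ (h 0) _).trans (by linarith)

end Conclusion

theorem measurePreserving_sample {𝒳 Ω : Type*} [MeasurableSpace 𝒳] [MeasurableSpace Ω]
    {P : Measure Ω} [IsProbabilityMeasure P] {N : ℕ} {X : Fin N → Ω → 𝒳}
    (hX : ∀ i, Measurable (X i)) (hindep : iIndepFun X P) {μ : Measure 𝒳}
    (hμ : ∀ i, P.map (X i) = μ) :
    MeasurePreserving (fun ω i => X i ω) P (Measure.pi fun _ : Fin N => μ) := by
  refine ⟨measurable_pi_lambda _ hX, ?_⟩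
  rw [(iIndepFun_iff_map_fun_eq_pi_map fun i => (hX i).aemeasurable).1 hindep]
  simp only [hμ]

/-- If the normal approximation bound computed from the estimate `v` in place of four times the
variance fails, then `v` exceeds four times the variance, and it is large compared with the bias
of the estimator. -/
theorem le_varEstimate_of_normal_bound_lt {n : ℕ} (hn : 1 ≤ n) {a b v S : ℝ} {d : ℝ≥0∞}
    (ha : 0 < a) (hb : 0 ≤ b) (hv : 0 < v) (hva : v ≤ n * (a / n) ^ 2 / 2)
    (hd2 : d ≤ ENNReal.ofReal 2)
    (hdS : 0 < S → d ≤ ENNReal.ofReal (√n * ((a / n) ^ 2 + n * (a / n * (b / n ^ 2))) / S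
      + n * (a / n) ^ 3 / (2 * √S ^ 3)))
    (hlt : ENNReal.ofReal (4 * (a ^ 2 + a * b) / (v * (n : ℝ) ^ (3 / 2 : ℝ))
      + 4 * a ^ 3 / (v ^ (3 / 2 : ℝ) * (n : ℝ) ^ 2)) < d) :
    4 * S ≤ v ∧ 8 * b ^ 2 / n ^ 2 ≤ v := by
  have hn' : (0 : ℝ) < n := by exact_mod_cast hn
  have hpow {t : ℝ} (ht : 0 ≤ t) : t ^ (3 / 2 : ℝ) = √t ^ 3 := by
    rw [Real.sqrt_eq_rpow, ← Real.rpow_natCast, ← Real.rpow_mul ht]; norm_num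
  rw [hpow hv.le, hpow hn'.le] at hlt
  set q := √(n : ℝ) with hq
  have hq0 : 0 < q := Real.sqrt_pos.2 hn'
  have hqn : (n : ℝ) = q ^ 2 := (Real.sq_sqrt hn'.le).symm
  rw [hqn] at hva hdS hlt ⊢
  have hsv : 0 < √v := Real.sqrt_pos.2 hv
  constructor
  · by_contra! hS
    have hS0 : 0 < S := by linarith
    refine absurd (hdS hS0) (not_le.2 (lt_of_le_of_lt (ENNReal.ofReal_le_ofReal ?_) hlt))
    have h1 : q * ((a / q ^ 2) ^ 2 + q ^ 2 * (a / q ^ 2 * (b / (q ^ 2) ^ 2))) / S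
        ≤ 4 * (a ^ 2 + a * b) / (v * q ^ 3) := by
      have : q * ((a / q ^ 2) ^ 2 + q ^ 2 * (a / q ^ 2 * (b / (q ^ 2) ^ 2))) / S
          = (a ^ 2 + a * b) / (S * q ^ 3) := by field_simp
      rw [this, div_le_div_iff₀ (by positivity) (by positivity)]
      have h2 : 0 ≤ (a ^ 2 + a * b) * q ^ 3 := by positivity
      nlinarith
    have h2 : q ^ 2 * (a / q ^ 2) ^ 3 / (2 * √S ^ 3) ≤ 4 * a ^ 3 / (√v ^ 3 * (q ^ 2) ^ 2) := by
      have h3 : √v ≤ 2 * √S := by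
        refine Real.sqrt_le_iff.2 ⟨by positivity, ?_⟩
        rw [mul_pow, Real.sq_sqrt hS0.le]; linarith
      have h4 : √v ^ 3 ≤ (2 * √S) ^ 3 := pow_le_pow_left₀ hsv.le h3 3
      have hsS : 0 < √S := Real.sqrt_pos.2 hS0
      have : q ^ 2 * (a / q ^ 2) ^ 3 / (2 * √S ^ 3) = a ^ 3 / (2 * √S ^ 3 * (q ^ 2) ^ 2) := by
        field_simp
      rw [this, div_le_div_iff₀ (by positivity) (by positivity)]
      have h5 : 0 ≤ a ^ 3 * (q ^ 2) ^ 2 := by positivity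
      nlinarith
    exact add_le_add h1 h2
  · have h1 := (ENNReal.ofReal_lt_ofReal_iff (by norm_num)).1 (hlt.trans_le hd2)
    have h2 : 0 ≤ 4 * a ^ 3 / (√v ^ 3 * (q ^ 2) ^ 2) := by positivity
    have h3 : 4 * (a ^ 2 + a * b) / (v * q ^ 3) < 2 := by linarith
    rw [div_lt_iff₀ (by positivity)] at h3
    have h4 : v * q ^ 2 ≤ a ^ 2 / 2 := by
      have : q ^ 2 * (a / q ^ 2) ^ 2 / 2 = a ^ 2 / 2 / q ^ 2 := by field_simp
      rwa [this, le_div_iff₀ (by positivity)] at hva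
    -- the two bounds on `v` force the interactions to be weak relative to `√n`
    have h5 : 4 * b ≤ a * q := by
      have : 4 * (a * b) ≤ a * (a * q) := by nlinarith [mul_le_mul_of_nonneg_right h4 hq0.le]
      exact le_of_mul_le_mul_left (by linarith) ha
    have h6 : 8 * b ^ 2 ≤ 2 * a * b * q := by nlinarith [mul_le_mul_of_nonneg_left h5 hb]
    have h7 : 2 * (a * b) ≤ v * q ^ 3 := by nlinarith
    rw [div_le_iff₀ (by positivity)]
    nlinarith [mul_le_mul_of_nonneg_right h7 hq0.le]

end WeakInteractions

open WeakInteractions in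
theorem theorem6 {𝒳 Ω : Type*} [MeasurableSpace 𝒳] [MeasurableSpace Ω]
    (P : Measure Ω) [IsProbabilityMeasure P]
    (n : ℕ) (hn : 1 ≤ n)
    (X : Fin (n + 1) → Ω → 𝒳) (hX : ∀ i, Measurable (X i))
    (hindep : iIndepFun X P) (hident : ∀ i j, IdentDistrib (X i) (X j) P P)
    (f : (Fin n → 𝒳) → ℝ) (hf : WeakInteractions.IsBoundedMeasurable f)
    (a b : ℝ) (ha : 0 < a) (hb : 0 ≤ b)
    (hweak : WeakInteractions.HasWeakInteractions a b f)
    (δ : ℝ) (hδ : 0 < δ) :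
    1 - δ ≤ P.real {ω |
      √(WeakInteractions.varEstimator f (fun i => X i ω)) / 2
          ≥ WeakInteractions.Kminus a b * √(Real.log (1 / δ)) / n →
      WeakInteractions.distNormal P (fun ω' => f (fun i : Fin n => X i.castSucc ω'))
        ≤ ENNReal.ofReal
          (4 * (a ^ 2 + a * b)
              / (WeakInteractions.varEstimator f (fun i => X i ω) * (n : ℝ) ^ (3 / 2 : ℝ))
            + 4 * a ^ 3
              / (WeakInteractions.varEstimator f (fun i => X i ω) ^ (3 / 2 : ℝ)
                  * (n : ℝ) ^ 2))} := by
  rcases le_or_gt 1 δ with hδ1 | hδ1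
  · exact (sub_nonpos.2 hδ1).trans measureReal_nonneg
  have hn' : (0 : ℝ) < n := by exact_mod_cast hn
  have hfb : BddMeas f := ⟨hf.1, hf.2⟩
  set μ : Measure 𝒳 := P.map (X 0)
  have hμP : IsProbabilityMeasure μ := Measure.isProbabilityMeasure_map (hX 0).aemeasurable
  have hμ (i : Fin (n + 1)) : P.map (X i) = μ := (hident i 0).map_eq
  have hmp := measurePreserving_sample hX hindep hμ
  have hmp' : MeasurePreserving (fun ω (i : Fin n) => X i.castSucc ω) P
      (Measure.pi fun _ : Fin n => μ) :=
    measurePreserving_sample (fun i => hX i.castSucc)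
      (hindep.precomp (Fin.castSucc_injective n)) fun i => hμ i.castSucc
  have hα := abs_sub_update_le_of_seminormM hf.2 hweak.1
  have hβ : ∀ l k, l ≠ k → ∀ x z z' y y',
      |partialDiff l z z' (partialDiff k y y' f) x| ≤ b / n ^ 2 := fun l k hlk =>
    abs_partialDiff_partialDiff_le_of_seminormJ hn hf.2 hweak.2 hlk
  have hα0 : 0 ≤ a / n := by positivity
  have hβ0 : 0 ≤ b / (n : ℝ) ^ 2 := by positivity
  set S : ℝ := variance f (Measure.pi fun _ : Fin n => μ)
  set d := distNormal P (fun ω' => f (fun i : Fin n => X i.castSucc ω'))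
  have hd2 : d ≤ ENNReal.ofReal 2 := distNormal_comp_le hmp' hfb fun h hh =>
    abs_integral_standardized_sub_gaussian_le_two hfb hh
  have hdS (hS : 0 < S) : d ≤ ENNReal.ofReal
      (√n * ((a / n) ^ 2 + n * (a / n * (b / n ^ 2))) / S + n * (a / n) ^ 3 / (2 * √S ^ 3)) :=
    distNormal_comp_le hmp' hfb fun h hh =>
      abs_integral_sub_gaussian_le μ hfb hα0 hβ0 hα hβ hS hh
  set ℓ : ℝ := Real.log (1 / δ) with hℓ
  have hℓ0 : 0 < ℓ := Real.log_pos (by rw [one_div]; exact (one_lt_inv₀ hδ).2 hδ1)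
  set K : ℝ := Kminus a b with hK
  have hK0 : 0 < K := by
    have : 0 < √(2 * a ^ 2 + 8 * b ^ 2) := Real.sqrt_pos.2 (by positivity)
    simp only [hK, Kminus]; positivity
  have hK2 : 2 * a ^ 2 + 8 * b ^ 2 ≤ K ^ 2 := by
    have h1 : √(2 * a ^ 2 + 8 * b ^ 2) ≤ K := by simp only [hK, Kminus]; linarith
    calc 2 * a ^ 2 + 8 * b ^ 2 = √(2 * a ^ 2 + 8 * b ^ 2) ^ 2 :=
          (Real.sq_sqrt (by positivity)).symm
      _ ≤ K ^ 2 := pow_le_pow_left₀ (Real.sqrt_nonneg _) h1 2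
  -- the level that the estimator exceeds wherever the implication fails
  set V : ℝ := max (max (4 * K ^ 2 * ℓ / n ^ 2) (4 * S)) (8 * b ^ 2 / n ^ 2)
  set good : Set Ω := {ω | √(varEstimator f (fun i => X i ω)) / 2 ≥ K * √ℓ / n →
    d ≤ ENNReal.ofReal (4 * (a ^ 2 + a * b)
      / (varEstimator f (fun i => X i ω) * (n : ℝ) ^ (3 / 2 : ℝ))
      + 4 * a ^ 3 / (varEstimator f (fun i => X i ω) ^ (3 / 2 : ℝ) * (n : ℝ) ^ 2))} with hgood
  have hbad : goodᶜ ⊆ (fun ω i => X i ω) ⁻¹' {x | V ≤ varEstimator f x} := by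
    intro ω hω
    simp only [hgood, Set.mem_compl_iff, Set.mem_ofPred_eq, Classical.not_imp, not_le] at hω
    obtain ⟨hA, hB⟩ := hω
    set v := varEstimator f (fun i => X i ω)
    have hv0 : 0 ≤ v := varEstimator_nonneg f _
    have h1 : 2 * (K * √ℓ / n) ≤ √v := by linarith
    have h2 : 0 < 2 * (K * √ℓ / n) := by
      have := Real.sqrt_pos.2 hℓ0
      positivity
    have hvpos : 0 < v := Real.sqrt_pos.1 (h2.trans_le h1)
    have h3 : 4 * K ^ 2 * ℓ / n ^ 2 ≤ v := by
      have h4 := pow_le_pow_left₀ h2.le h1 2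
      rw [Real.sq_sqrt hv0] at h4
      refine le_trans (le_of_eq ?_) h4
      rw [mul_pow, div_pow, mul_pow, Real.sq_sqrt hℓ0.le]
      ring
    obtain ⟨h4, h5⟩ := le_varEstimate_of_normal_bound_lt hn ha hb hvpos
      (varEstimator_le hα _) hd2 hdS hB
    exact max_le (max_le h3 h4) h5
  have hA0 : 0 < 3 * (a / n) ^ 2 + 12 * (n : ℝ) ^ 2 * (b / n ^ 2) ^ 2 := by positivity
  have htail := measureReal_ge_le_of_selfBounding μ (bddMeas_varEstimator hfb)
    (bddMeas_decreaseBound hfb (b / n ^ 2)) (varEstimator_sub_update_le hβ0 hβ) hA0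
    (sum_sq_decreaseBound_le hn hα) V
  have hmean := integral_varEstimator_le μ hfb hβ0 hβ
  set m : ℝ := ∫ x, varEstimator f x ∂(Measure.pi fun _ : Fin (n + 1) => μ)
  have hexp : ℓ ≤ (V - 2 * m) / (3 * (a / n) ^ 2 + 12 * (n : ℝ) ^ 2 * (b / n ^ 2) ^ 2) := by
    rw [le_div_iff₀ hA0]
    have h1 : 4 * K ^ 2 * ℓ / n ^ 2 ≤ V := (le_max_left _ _).trans (le_max_left _ _)
    have h2 : 4 * S ≤ V := (le_max_right _ _).trans (le_max_left _ _)
    have h3 : 8 * b ^ 2 / n ^ 2 ≤ V := le_max_right _ _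
    have h4 : (n : ℝ) ^ 2 * (b / n ^ 2) ^ 2 / 4 = (8 * b ^ 2 / n ^ 2) / 32 := by
      field_simp; ring
    have h5 : 3 * (a / n) ^ 2 + 12 * (n : ℝ) ^ 2 * (b / n ^ 2) ^ 2
        = (3 * a ^ 2 + 12 * b ^ 2) / n ^ 2 := by field_simp
    rw [h4] at hmean
    have h6 : ℓ * ((3 * a ^ 2 + 12 * b ^ 2) / n ^ 2) ≤ 7 / 16 * (4 * K ^ 2 * ℓ / n ^ 2) := by
      rw [mul_div_assoc', mul_div_assoc']
      refine div_le_div_of_nonneg_right ?_ (by positivity)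
      nlinarith [sq_nonneg a, sq_nonneg b]
    rw [h5]
    linarith
  have hcompl : P.real goodᶜ ≤ δ := by
    calc P.real goodᶜ ≤ P.real ((fun ω i => X i ω) ⁻¹' {x | V ≤ varEstimator f x}) :=
          measureReal_mono hbad
      _ = (Measure.pi fun _ : Fin (n + 1) => μ).real {x | V ≤ varEstimator f x} :=
          hmp.measureReal_preimage (measurableSet_le measurable_const
            (bddMeas_varEstimator hfb).measurable).nullMeasurableSet
      _ ≤ Real.exp (-ℓ) := htail.trans (Real.exp_le_exp.2 (neg_le_neg hexp))
      _ = δ := by rw [hℓ, one_div, Real.log_inv, neg_neg, Real.exp_log hδ]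
  have hunion := measureReal_union_le (μ := P) good goodᶜ
  rw [Set.union_compl_self, probReal_univ] at hunion
  linarith
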